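/- Let $n\ge 3$, $1\le p<n$ ($p$ real), and let $\Omega\subset\mathbb{R}^n$ be a bounded $C^1$ domain that contains the origin and is star-shaped with respect to it, that is, $tx\in\Omega$ for all $x\in\Omega$ and $t\in[0,1]$. Put $\Omega_0=\Omega\setminus\{0\}$, and suppose that $f\in C^1(\overline{\Omega}\setminus\{0\};\mathbb{R}^n)\cap L^\infty(\Omega;\mathbb{R}^n)$ solves the boundary value problem $$(x\cdot\nabla)f(x)=0\quad (x\in\Omega_0),\qquad f(x)=x\quad (x\in\partial\Omega).$$ Let $u\in W^{1,p}(\Omega)$ be real-valued with weak gradient $\nabla u$. Then $u$ has a trace $Tu\in L^p(\partial\Omega)$, meaning that some sequence $v_k$ of restrictions of $C^1(\mathbb{R}^n)$ functions converges to $u$ in $W^{1,p}(\Omega)$ while $v_k|_{\partial\Omega}\to Tu$ in $L^p(\partial\Omega)$ with respect to $(n-1)$-dimensional Hausdorff measure. Moreover, writing $u\circ f:=(Tu)\circ f$ for any such trace (the values of $f$ on $\Omega_0$ lie on $\partial\Omega$), the function $|u-u\circ f|^p/|x|^p$ is integrable on $\Omega$ and $$\int_\Omega\frac{|u-u\circ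 f|^p}{|x|^p}\,dx\le\left(\frac{p}{n-p}\right)^p\int_\Omega\left|\frac{x}{|x|}\cdot\nabla u\right|^p\,dx .$$ -/

import Mathlib

open MeasureTheory Filter Topology
open scoped ContDiff ENNReal

noncomputable section

/-- Euclidean space `ℝⁿ` with the Euclidean norm. -/
abbrev Rn (n : ℕ) : Type := EuclideanSpace ℝ (Fin n)

/-- `Ω` is a `C¹` domain: open, connected, nonempty, and near each boundary point `y`
it is the set of points lying, in the direction of some unit vector `e`, strictly above the
graph of a `C¹` function `γ` of the component `x - ⟨e, x⟩ e` orthogonal to `e`. -/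
structure IsC1Domain {n : ℕ} (Ω : Set (Rn n)) : Prop where
  isOpen : IsOpen Ω
  isConnected : IsConnected Ω
  boundary : ∀ y ∈ frontier Ω, ∃ e : Rn n, ‖e‖ = 1 ∧ ∃ γ : Rn n → ℝ, ContDiff ℝ 1 γ ∧
    ∃ r : ℝ, 0 < r ∧
      Ω ∩ Metric.ball y r =
        {x | γ (x - inner ℝ e x • e) < inner ℝ e x} ∩ Metric.ball y r

/-- `u ∈ W^{1,p}(Ω)` with weak gradient `g`: both `u` and `g` are in `L^p(Ω)`, and
`∫_Ω u ∂_w φ = - ∫_Ω ⟨g, w⟩ φ` for all test functions `φ ∈ C_c^∞(Ω)` and directions `w`. -/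
structure MemW1p {n : ℕ} (Ω : Set (Rn n)) (p : ℝ) (u : Rn n → ℝ) (g : Rn n → Rn n) : Prop where
  memLp : MemLp u (ENNReal.ofReal p) (volume.restrict Ω)
  memLp_grad : MemLp g (ENNReal.ofReal p) (volume.restrict Ω)
  weak_grad : ∀ φ : Rn n → ℝ, ContDiff ℝ ∞ φ → HasCompactSupport φ → tsupport φ ⊆ Ω →
    ∀ w : Rn n,
      ∫ x in Ω, u x * fderiv ℝ φ x w = - ∫ x in Ω, inner ℝ (g x) w * φ x

/-- Surface measure on `∂Ω`: `(n-1)`-dimensional Hausdorff measure restricted to `∂Ω`. -/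
def surfaceMeasure {n : ℕ} (Ω : Set (Rn n)) : Measure (Rn n) :=
  (Measure.hausdorffMeasure ((n : ℝ) - 1)).restrict (frontier Ω)

/-- `T` represents the trace on `∂Ω` of the function `u ∈ W^{1,p}(Ω)` with weak gradient `g`:
`T ∈ L^p(∂Ω)` is the `L^p(∂Ω)`-limit of the boundary values of functions that are `C¹` up to
the boundary and converge to `u` in `W^{1,p}(Ω)`. -/
structure IsTrace {n : ℕ} (Ω : Set (Rn n)) (p : ℝ) (u : Rn n → ℝ) (g : Rn n → Rn n)
    (T : Rn n → ℝ) : Prop where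
  memLp : MemLp T (ENNReal.ofReal p) (surfaceMeasure Ω)
  approx : ∃ v : ℕ → Rn n → ℝ, (∀ k, ContDiff ℝ 1 (v k)) ∧
    Tendsto (fun k => eLpNorm (fun x => v k x - u x) (ENNReal.ofReal p) (volume.restrict Ω))
      atTop (𝓝 0) ∧
    Tendsto (fun k => eLpNorm (fun x => gradient (v k) x - g x) (ENNReal.ofReal p)
      (volume.restrict Ω)) atTop (𝓝 0) ∧
    Tendsto (fun k => eLpNorm (fun x => v k x - T x) (ENNReal.ofReal p) (surfaceMeasure Ω))
      atTop (𝓝 0)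

end

/-!
# A Hardy inequality with boundary values on star-shaped domains

The boundary value problem says that `f` is constant along rays and equals the identity on `∂Ω`,
so `f` is the radial projection of `Ω \ {0}` onto `∂Ω`
(`isRadialProjection_of_boundaryValueProblem`). Continuity of `f` up to the boundary forces each
ray to meet `∂Ω` exactly once, and after this the rest of the argument uses only the map `f`: the
local graph description of `∂Ω` is not needed.

For `v` of class `C¹`, integrating `∇v` along the segment from `x` to `f x` gives
`|v x - v (f x)| / |x| ≤ ∫₁^∞ h (s x) ds`, where `h` is the absolute value of the radial
derivative of `v` on `Ω`, extended by zero. Dilation by `s` scales the `L^p` norm by `s ^ (-n/p)`,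
so Minkowski's integral inequality yields the constant `∫₁^∞ s ^ (-n/p) ds = p / (n - p)`
(`lintegral_rpow_lintegral_dilation_le`, `IsRadialProjection.hardy_of_contDiff`).

The passage to Sobolev functions compares surface measure with the image `σ` of Lebesgue measure
on `Ω` under `f`. The cone over a boundary ball of radius `r` has volume comparable to
`r ^ (n - 1)`. The lower bound and a Vitali covering give that surface measure is at most `C σ`
(`IsRadialProjection.exists_surfaceMeasure_le`); combined with the Hardy inequality for `C¹`
functions this is the trace inequality (`IsRadialProjection.exists_eLpNorm_surfaceMeasure_le`).
The upper bound gives `σ ≪` surface measure (`IsRadialProjection.map_absolutelyContinuous`), so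
that convergence almost everywhere on `∂Ω` can be pulled back by `f`. Restrictions of `C¹`
functions are dense in `W^{1,p}(Ω)`, as a dilation moves a star-shaped domain away from its
boundary before mollification (`IsRadialProjection.exists_contDiff_tendsto`). Hence traces exist,
and the inequality for `u` follows from Fatou's lemma
(`IsRadialProjection.eLpNorm_sub_trace_div_le`).
-/

/-! ### Radial projections onto the boundary -/

/-- `f` is the radial projection of the punctured set `Ω \ {0}` onto `∂Ω`, and it is `C¹`:
every `x ∈ Ω \ {0}` is sent to a boundary point `t • x` with `t > 1`, and every point
of the open segment from `0` to a boundary point `y` lies in `Ω` and is sent to `y`.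
In particular each ray from the origin meets `∂Ω` in exactly one point. -/
structure IsRadialProjection {n : ℕ} (Ω : Set (Rn n)) (f : Rn n → Rn n) : Prop where
  isOpen : IsOpen Ω
  isBounded : Bornology.IsBounded Ω
  zero_mem : (0 : Rn n) ∈ Ω
  contDiffOn : ContDiffOn ℝ 1 f (Ω \ {0})
  exists_smul : ∀ x ∈ Ω, x ≠ 0 → f x ∈ frontier Ω ∧ ∃ t : ℝ, 1 < t ∧ f x = t • x
  smul_frontier : ∀ y ∈ frontier Ω, ∀ s : ℝ, 0 < s → s < 1 → s • y ∈ Ω ∧ f (s • y) = y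

/-- A solution of `(x · ∇) f = 0` is constant along radial segments in `Ω`, up to the boundary. -/
theorem eq_of_radial_fderiv_eq_zero {n : ℕ} {Ω : Set (Rn n)} {f : Rn n → Rn n} (hΩ : IsOpen Ω)
    (hf_C1 : ContDiffOn ℝ 1 f (closure Ω \ {0}))
    (hf_radial : ∀ x ∈ Ω \ {0}, fderiv ℝ f x x = 0) {x : Rn n} (hx : x ≠ 0) {a b : ℝ}
    (ha : 0 < a) (hab : a ≤ b) (hs : ∀ s, a ≤ s → s < b → s • x ∈ Ω) (hb : b • x ∈ closure Ω) :
    f (b • x) = f (a • x) := by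
  have hmem : ∀ s ∈ Set.Icc a b, s • x ∈ closure Ω \ {0} := fun s h =>
    ⟨h.2.lt_or_eq.elim (fun h' => subset_closure (hs s h.1 h')) (fun h' => h' ▸ hb),
      smul_ne_zero (ha.trans_le h.1).ne' hx⟩
  refine constant_of_has_deriv_right_zero (f := fun s : ℝ => f (s • x)) (a := a) (b := b)
    (hf_C1.continuousOn.comp (by fun_prop) hmem) (fun s h => ?_) b ⟨hab, le_rfl⟩
  have hsx : s • x ∈ Ω \ {0} := ⟨hs s h.1 h.2, (hmem s ⟨h.1, h.2.le⟩).2⟩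
  have hd : DifferentiableAt ℝ f (s • x) :=
    (hf_C1.differentiableOn one_ne_zero).differentiableAt
      (mem_of_superset ((hΩ.sdiff isClosed_singleton).mem_nhds hsx)
        (Set.sdiff_subset_sdiff_left subset_closure))
  have h1 := hd.hasFDerivAt.comp_hasDerivAt s ((hasDerivAt_id s).smul_const x)
  have h2 : fderiv ℝ f (s • x) x = 0 := by
    have := hf_radial _ hsx
    rw [map_smul] at this
    exact (smul_eq_zero.1 this).resolve_left (ha.trans_le h.1).ne'
  simp only [one_smul] at h1
  rw [h2] at h1
  exact h1.hasDerivWithinAt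

/-- In a bounded open star-shaped set, the ray through `x` leaves the set at a first
time `t > 1`. -/
theorem exists_smul_mem_frontier {n : ℕ} {Ω : Set (Rn n)} (hΩ : IsOpen Ω)
    (hb : Bornology.IsBounded Ω) (hstar : StarConvex ℝ (0 : Rn n) Ω) {x : Rn n} (hx : x ∈ Ω)
    (hx0 : x ≠ 0) :
    ∃ t : ℝ, 1 < t ∧ t • x ∈ frontier Ω ∧ ∀ s, 0 ≤ s → s < t → s • x ∈ Ω := by
  rw [starConvex_zero_iff] at hstar
  have hcont : Continuous fun s : ℝ => s • x := by fun_prop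
  set A : Set ℝ := {s | 0 ≤ s ∧ s • x ∉ Ω} with hA
  have hAc : IsClosed A := by
    have : A = Set.Ici 0 ∩ (fun s : ℝ => s • x) ⁻¹' Ωᶜ := rfl
    rw [this]
    exact isClosed_Ici.inter (hΩ.isClosed_compl.preimage hcont)
  have hAb : BddBelow A := ⟨0, fun s hs => hs.1⟩
  have hAn : A.Nonempty := by
    obtain ⟨R, hR⟩ := hb.subset_closedBall (0 : Rn n)
    have hxn : 0 < ‖x‖ := norm_pos_iff.2 hx0
    have hR0 : 0 ≤ R := by simpa using (norm_nonneg x).trans (by simpa using hR hx)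
    refine ⟨(R + 1) / ‖x‖, by positivity, fun h => ?_⟩
    have := hR h
    rw [mem_closedBall_zero_iff, norm_smul, Real.norm_of_nonneg (by positivity),
      div_mul_cancel₀ _ hxn.ne'] at this
    linarith
  have ht := hAc.csInf_mem hAn hAb
  set t := sInf A
  have hlt : ∀ s, 0 ≤ s → s < t → s • x ∈ Ω := fun s h0 h => by
    by_contra hc
    exact (notMem_of_lt_csInf h hAb) ⟨h0, hc⟩
  have ht1 : 1 < t := by
    by_contra! hc
    exact ht.2 (hstar hx ht.1 hc)
  refine ⟨t, ht1, ?_, hlt⟩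
  rw [hΩ.frontier_eq]
  refine ⟨?_, ht.2⟩
  have : t ∈ closure (Set.Ico 0 t) := by
    rw [closure_Ico (by linarith : (0:ℝ) ≠ t)]; exact ⟨by linarith, le_rfl⟩
  exact map_mem_closure (f := fun s : ℝ => s • x) hcont this fun s hs => hlt s hs.1 hs.2

/-- A solution of the boundary value problem is the radial projection onto `∂Ω`. That no ray
meets `∂Ω` twice is forced by the continuity of `f` at the boundary: for `y ∈ ∂Ω` and small `s`,
the values `f x = f (s • x)` for `x ∈ Ω` near `y` tend both to `f y = y` and to `f (s • y)`. -/
theorem isRadialProjection_of_boundaryValueProblem {n : ℕ} {Ω : Set (Rn n)} {f : Rn n → Rn n}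
    (hΩ : IsOpen Ω) (hne : Ω.Nonempty) (hb : Bornology.IsBounded Ω)
    (hstar : StarConvex ℝ (0 : Rn n) Ω)
    (hf_C1 : ContDiffOn ℝ 1 f (closure Ω \ {0}))
    (hf_radial : ∀ x ∈ Ω \ {0}, fderiv ℝ f x x = 0)
    (hf_boundary : ∀ x ∈ frontier Ω, f x = x) : IsRadialProjection Ω f := by
  have h0 : (0 : Rn n) ∈ Ω := by
    obtain ⟨x, hx⟩ := hne
    simpa using starConvex_zero_iff.1 hstar hx le_rfl zero_le_one
  have key : ∀ x ∈ Ω, x ≠ 0 → ∃ t : ℝ, 1 < t ∧ t • x ∈ frontier Ω ∧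
      ∀ s, 0 < s → s < t → s • x ∈ Ω ∧ f (s • x) = t • x := fun x hx hx0 => by
    obtain ⟨t, ht, htf, hs⟩ := exists_smul_mem_frontier hΩ hb hstar hx hx0
    refine ⟨t, ht, htf, fun s hs0 hst => ⟨hs s hs0.le hst, ?_⟩⟩
    rw [← hf_boundary _ htf]
    exact (eq_of_radial_fderiv_eq_zero hΩ hf_C1 hf_radial hx0 hs0 hst.le
      (fun r hr => hs r (hs0.le.trans hr)) (frontier_subset_closure htf)).symm
  refine ⟨hΩ, hb, h0, hf_C1.mono (Set.sdiff_subset_sdiff_left subset_closure), ?_, ?_⟩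
  · intro x hx hx0
    obtain ⟨t, ht, htf, hs⟩ := key x hx hx0
    have := (hs 1 one_pos ht).2
    rw [one_smul] at this
    exact ⟨this ▸ htf, t, ht, this⟩
  · intro y hy
    have hyΩ : y ∉ Ω := by rw [hΩ.frontier_eq] at hy; exact hy.2
    have hy0 : y ≠ 0 := fun h => hyΩ (h ▸ h0)
    -- a small multiple of `y` lies in `Ω`
    obtain ⟨s, hs0, hs1, hsy⟩ : ∃ s : ℝ, 0 < s ∧ s < 1 ∧ s • y ∈ Ω := by
      have hc : Tendsto (fun s : ℝ => s • y) (𝓝[>] 0) (𝓝 0) := by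
        have : Continuous fun s : ℝ => s • y := by fun_prop
        simpa using (this.tendsto 0).mono_left nhdsWithin_le_nhds
      obtain ⟨s, h1, h2, h3⟩ := ((hc.eventually (hΩ.mem_nhds h0)).and
        ((eventually_mem_nhdsWithin).and
          (nhdsWithin_le_nhds (Iio_mem_nhds (zero_lt_one' ℝ))))).exists
      exact ⟨s, h2, h3, h1⟩
    have hfs : f (s • y) = y := by
      have hne' : (𝓝[Ω \ {0}] y).NeBot := by
        rw [← mem_closure_iff_nhdsWithin_neBot]
        have : y ∈ closure Ω ∩ {0}ᶜ := ⟨frontier_subset_closure hy, hy0⟩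
        exact isOpen_compl_singleton.closure_inter this
      have hsub : Ω \ {0} ⊆ closure Ω \ {0} := Set.sdiff_subset_sdiff_left subset_closure
      have t1 : Tendsto f (𝓝[Ω \ {0}] y) (𝓝 y) := by
        have := (hf_C1.continuousOn y ⟨frontier_subset_closure hy, hy0⟩).mono hsub
        rwa [ContinuousWithinAt, hf_boundary y hy] at this
      have t2 : Tendsto (fun x => f (s • x)) (𝓝[Ω \ {0}] y) (𝓝 (f (s • y))) := by
        have c1 : ContinuousAt f (s • y) := hf_C1.continuousOn.continuousAt
          (mem_of_superset ((hΩ.sdiff isClosed_singleton).mem_nhds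
            ⟨hsy, smul_ne_zero hs0.ne' hy0⟩) hsub)
        have c2 : ContinuousAt (fun x : Rn n => s • x) y := by fun_prop
        exact (ContinuousAt.comp (f := fun x : Rn n => s • x) c1 c2).tendsto.mono_left
          nhdsWithin_le_nhds
      refine tendsto_nhds_unique t2 (t1.congr' ?_)
      filter_upwards [self_mem_nhdsWithin] with x hx
      obtain ⟨t, ht, -, h⟩ := key x hx.1 hx.2
      rw [(h s hs0 (hs1.trans ht)).2, ← (h 1 one_pos ht).2, one_smul]
    obtain ⟨t, ht, -, h⟩ := key _ hsy (smul_ne_zero hs0.ne' hy0)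
    have hts : t * s = 1 := by
      have h1 := (h 1 one_pos ht).2
      rw [one_smul, hfs, smul_smul] at h1
      have : (t * s - 1) • y = 0 := by rw [sub_smul, ← h1, one_smul, sub_self]
      linarith [(smul_eq_zero.1 this).resolve_right hy0]
    intro r hr0 hr1
    have h2 := h (r / s) (by positivity) (by
      rw [div_lt_iff₀ hs0, hts]; exact hr1)
    rwa [smul_smul, smul_smul, hts, one_smul, div_mul_cancel₀ _ hs0.ne'] at h2

namespace IsRadialProjection

variable {n : ℕ} {Ω : Set (Rn n)} {f : Rn n → Rn n}

theorem smul_mem (h : IsRadialProjection Ω f) {x : Rn n} (hx : x ∈ closure Ω) {s : ℝ}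
    (hs0 : 0 < s) (hs1 : s < 1) : s • x ∈ Ω := by
  by_cases hf : x ∈ frontier Ω
  · exact (h.smul_frontier x hf s hs0 hs1).1
  have hxΩ : x ∈ Ω := by
    rw [h.isOpen.frontier_eq] at hf
    by_contra hc
    exact hf ⟨hx, hc⟩
  rcases eq_or_ne x 0 with rfl | hx0
  · simpa using hxΩ
  obtain ⟨hfr, t, ht, hft⟩ := h.exists_smul x hxΩ hx0
  have := (h.smul_frontier _ hfr (s / t) (by positivity)
    ((div_lt_one (by linarith)).2 (hs1.trans ht))).1
  rwa [hft, smul_smul, div_mul_cancel₀ _ (by linarith : t ≠ 0)] at this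

theorem smul_mem_of_eq (h : IsRadialProjection Ω f) {x : Rn n} (hx : x ∈ Ω) (hx0 : x ≠ 0)
    {t s : ℝ} (hft : f x = t • x) (hs0 : 0 < s) (hst : s < t) :
    s • x ∈ Ω := by
  have ht : 0 < t := hs0.trans hst
  have := (h.smul_frontier _ (h.exists_smul x hx hx0).1 (s / t) (by positivity)
    ((div_lt_one ht).2 hst)).1
  rwa [hft, smul_smul, div_mul_cancel₀ _ ht.ne'] at this

theorem ne_zero_of_mem_frontier (h : IsRadialProjection Ω f) {y : Rn n} (hy : y ∈ frontier Ω) :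
    y ≠ 0 := by
  rintro rfl
  rw [h.isOpen.frontier_eq] at hy
  exact hy.2 h.zero_mem

theorem isOpen_punctured (h : IsRadialProjection Ω f) : IsOpen (Ω \ {0}) :=
  h.isOpen.sdiff isClosed_singleton

theorem ae_mem_punctured [NeZero n] (h : IsRadialProjection Ω f) :
    ∀ᵐ x ∂(volume.restrict Ω), x ∈ Ω \ {0} := by
  have h0 : ∀ᵐ x ∂(volume.restrict Ω), x ≠ (0 : Rn n) :=
    ae_restrict_of_ae (by simp [ae_iff])
  filter_upwards [ae_restrict_mem h.isOpen.measurableSet, h0] with x hx hx0 using ⟨hx, hx0⟩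

theorem aemeasurable [NeZero n] (h : IsRadialProjection Ω f) :
    AEMeasurable f (volume.restrict Ω) := by
  have : volume.restrict Ω = volume.restrict (Ω \ {0}) :=
    Measure.restrict_congr_set ((sdiff_null_ae_eq_self (by simp)).symm)
  rw [this]
  exact h.contDiffOn.continuousOn.aemeasurable h.isOpen_punctured.measurableSet

end IsRadialProjection

/-! ### Comparison of Hausdorff measure with an outer regular measure -/

/-- If a measure `σ` gives mass at least `c r ^ d` to all small balls centred in `A`, then it
dominates the `d`-dimensional Hausdorff measure on `A`: a disjoint Vitali family of small balls
inside an open set of almost minimal measure covers `A` after fivefold enlargement. -/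
theorem hausdorffMeasure_le_of_le_measure_closedBall {X : Type*} [MetricSpace X]
    [SecondCountableTopology X] [MeasurableSpace X] [BorelSpace X] (σ : Measure X)
    [σ.OuterRegular] {d c r₀ : ℝ} (hd : 0 < d) (hc : 0 < c) (hr₀ : 0 < r₀) {A : Set X}
    (hA : ∀ x ∈ A, ∀ r, 0 < r → r ≤ r₀ →
      ENNReal.ofReal (c * r ^ d) ≤ σ (Metric.closedBall x r)) :
    μH[d] A ≤ ENNReal.ofReal (10 ^ d / c) * σ A := by
  refine ENNReal.le_of_forall_pos_le_add fun η hη hfin => ?_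
  set C := ENNReal.ofReal (10 ^ d / c) with hC
  have hC0 : C ≠ 0 := by rw [hC, Ne, ENNReal.ofReal_eq_zero, not_le]; positivity
  obtain ⟨U, hAU, hU, hσU⟩ := A.exists_isOpen_le_add σ
    (ε := η / C) (ENNReal.div_ne_zero.2 ⟨by simpa using hη.ne', ENNReal.ofReal_ne_top⟩)
  have hσU' : C * σ U ≤ C * σ A + η := by
    calc C * σ U ≤ C * (σ A + η / C) := by gcongr
      _ = _ := by rw [mul_add, ENNReal.mul_div_cancel hC0 ENNReal.ofReal_ne_top]
  refine le_trans ?_ hσU'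
  -- radii of balls that stay in `U`
  have hrad : ∀ x : A, ∃ r, 0 < r ∧ Metric.closedBall (x : X) r ⊆ U := fun x =>
    Metric.nhds_basis_closedBall.mem_iff.1 (hU.mem_nhds (hAU x.2))
  choose ρ hρ hρU using hrad
  -- the radii are also capped by `1 / (k + 1)`, so that the cover becomes fine as `k → ∞`
  have hfam : ∀ k : ℕ, ∃ u : Set A, u.Countable ∧
      (u.PairwiseDisjoint fun a => Metric.closedBall (a : X)
        (min (ρ a) (min r₀ (1 / (k + 1 : ℝ))))) ∧
      A ⊆ ⋃ a : u, Metric.closedBall ((a : A) : X)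
        (5 * (min (ρ a) (min r₀ (1 / (k + 1 : ℝ))))) := fun k => by
    have hpos : ∀ a : A, 0 < min (ρ a) (min r₀ (1 / (k + 1 : ℝ))) := fun a =>
      lt_min (hρ a) (lt_min hr₀ (by positivity))
    obtain ⟨u, -, hdisj, hcov⟩ := Vitali.exists_disjoint_subfamily_covering_enlargement_closedBall
      (Set.univ : Set A) (fun a => (a : X)) (fun a => min (ρ a) (min r₀ (1 / (k + 1 : ℝ)))) r₀
      (fun a _ => (min_le_right _ _).trans (min_le_left _ _)) 5 (by norm_num)
    refine ⟨u, hdisj.countable_of_nonempty_interior fun a _ => ?_, hdisj, fun x hx => ?_⟩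
    · exact ⟨a, mem_interior_iff_mem_nhds.2 (Metric.closedBall_mem_nhds _ (hpos a))⟩
    · obtain ⟨b, hb, hsub⟩ := hcov ⟨x, hx⟩ trivial
      exact Set.mem_iUnion.2 ⟨⟨b, hb⟩, hsub (Metric.mem_closedBall_self (hpos _).le)⟩
  choose u hucount hudisj hucov using hfam
  have (k : ℕ) : Countable (u k) := (hucount k).to_subtype
  set R : ∀ k : ℕ, A → ℝ := fun k a => min (ρ a) (min r₀ (1 / (k + 1 : ℝ))) with hR
  have hRpos : ∀ k a, 0 < R k a := fun k a =>
    lt_min (hρ a) (lt_min hr₀ (by positivity))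
  have hdiam : ∀ k (a : u k), Metric.ediam (Metric.closedBall ((a : A) : X) (5 * R k a)) ≤
      ENNReal.ofReal (10 * R k a) := fun k a => by
    rw [show (10 : ℝ) * R k a = 2 * (5 * R k a) by ring, ENNReal.ofReal_mul zero_le_two,
      ← Metric.closedEBall_ofReal (by linarith [hRpos k a])]
    simpa using Metric.ediam_closedEBall_le
  refine (Measure.hausdorffMeasure_le_liminf_tsum d A (l := atTop)
    (fun k : ℕ => ENNReal.ofReal (10 * (1 / (k + 1 : ℝ)))) ?_
    (fun k (a : u k) => Metric.closedBall ((a : A) : X) (5 * R k a)) ?_ ?_).trans ?_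
  · have : Tendsto (fun k : ℕ => 10 * (1 / (k + 1 : ℝ))) atTop (𝓝 (10 * 0)) :=
      tendsto_one_div_add_atTop_nhds_zero_nat.const_mul _
    simpa using ENNReal.tendsto_ofReal this
  · refine Eventually.of_forall fun k a => (hdiam k a).trans (ENNReal.ofReal_le_ofReal ?_)
    gcongr
    exact (min_le_right _ _).trans (min_le_right _ _)
  · exact Eventually.of_forall hucov
  refine Filter.liminf_le_of_frequently_le' (Frequently.of_forall fun k => ?_)
  calc ∑' a : u k, Metric.ediam (Metric.closedBall ((a : A) : X) (5 * R k a)) ^ d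
      ≤ ∑' a : u k, C * σ (Metric.closedBall ((a : A) : X) (R k a)) := by
        refine ENNReal.tsum_le_tsum fun a => ?_
        calc _ ≤ ENNReal.ofReal (10 * R k a) ^ d := ENNReal.rpow_le_rpow (hdiam k a) hd.le
          _ = C * ENNReal.ofReal (c * R k a ^ d) := by
            rw [ENNReal.ofReal_rpow_of_pos (by linarith [hRpos k a]), hC,
              ← ENNReal.ofReal_mul (by positivity),
              Real.mul_rpow (by norm_num) (hRpos k a).le]
            congr 1
            field_simp
          _ ≤ _ := by
            gcongr
            exact hA _ (a : A).2 _ (hRpos k a) ((min_le_right _ _).trans (min_le_left _ _))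
    _ = C * σ (⋃ a : u k, Metric.closedBall ((a : A) : X) (R k a)) := by
        rw [ENNReal.tsum_mul_left, measure_iUnion (ι := u k)
          (fun a b hab => hudisj k a.2 b.2 fun h => hab (Subtype.ext h))
          fun a => Metric.isClosed_closedBall.measurableSet]
    _ ≤ C * σ U := by
        gcongr
        exact Set.iUnion_subset fun a =>
          (Metric.closedBall_subset_closedBall (min_le_left _ _)).trans (hρU a)

/-! ### The Hardy inequality for continuously differentiable functions -/

/-- Jensen's inequality for `t ↦ t ^ p` and a probability measure. -/
theorem rpow_lintegral_le_lintegral_rpow {α : Type*} [MeasurableSpace α] (μ : Measure α)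
    [IsProbabilityMeasure μ] {h : α → ℝ≥0∞} (hh : AEMeasurable h μ) {p : ℝ} (hp : 1 ≤ p) :
    (∫⁻ x, h x ∂μ) ^ p ≤ ∫⁻ x, h x ^ p ∂μ := by
  have := eLpNorm'_le_eLpNorm'_of_exponent_le one_pos hp μ hh.aestronglyMeasurable
  simp only [eLpNorm', enorm_eq_self, ENNReal.rpow_one, div_one] at this
  calc _ ≤ _ := ENNReal.rpow_le_rpow this (by linarith)
    _ = _ := by rw [← ENNReal.rpow_mul, one_div_mul_cancel (by linarith), ENNReal.rpow_one]

theorem lintegral_comp_smul_Rn {n : ℕ} (h : Rn n → ℝ≥0∞) {s : ℝ} (hs : 0 < s) :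
    ∫⁻ x, h (s • x) = ENNReal.ofReal ((s ^ n)⁻¹) * ∫⁻ x, h x := by
  have e : MeasurableEmbedding fun x : Rn n => s • x :=
    (Homeomorph.smulOfNeZero s hs.ne').measurableEmbedding
  rw [← e.lintegral_map (μ := volume) h, Measure.map_addHaar_smul _ hs.ne', lintegral_smul_measure,
    finrank_euclideanSpace_fin, abs_of_pos (by positivity), smul_eq_mul]

/-- Minkowski's integral inequality for the average of the dilates `h (s • x)`, `s > 1`, which
carries the sharp Hardy constant `∫₁^∞ s ^ (-n/p) ds = p / (n - p)`. It follows from Jensen's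
inequality for the probability measure with density proportional to `s ^ (-n/p)` on `(1, ∞)`. -/
theorem lintegral_rpow_lintegral_dilation_le {n : ℕ} {p : ℝ} (hp1 : 1 ≤ p) (hpn : p < n)
    {h : Rn n → ℝ≥0∞} (hh : Measurable h) :
    ∫⁻ x, (∫⁻ s in Set.Ioi (1 : ℝ), h (s • x)) ^ p ≤
      ENNReal.ofReal (p / (n - p)) ^ p * ∫⁻ x, h x ^ p := by
  have hp0 : 0 < p := by linarith
  set a : ℝ := n / p with ha
  have ha1 : 1 < a := by rw [ha, one_lt_div hp0]; exact hpn
  set c : ℝ := a - 1 with hc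
  have hc0 : 0 < c := by linarith
  have hcinv : p / (n - p) = c⁻¹ := by
    rw [hc, ha]
    have : (n : ℝ) - p ≠ 0 := by linarith
    field_simp
  set w : ℝ → ℝ≥0∞ := fun t => ENNReal.ofReal (c * t ^ (-a)) with hw
  have hwm : Measurable w := by fun_prop
  set μ : Measure ℝ := (volume.restrict (Set.Ioi 1)).withDensity w with hμ
  have hac : μ ≪ volume.restrict (Set.Ioi 1) := withDensity_absolutelyContinuous _ _
  have hae : ∀ᵐ t ∂μ, (1 : ℝ) < t := hac.ae_le (ae_restrict_mem measurableSet_Ioi)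
  have : IsProbabilityMeasure μ := by
    refine ⟨?_⟩
    rw [hμ, withDensity_apply _ MeasurableSet.univ, Measure.restrict_univ,
      ← ofReal_integral_eq_lintegral_ofReal]
    · rw [integral_const_mul, integral_Ioi_rpow_of_lt (by linarith) one_pos, Real.one_rpow,
        show -a + 1 = -c by rw [hc]; ring, neg_div_neg_eq, mul_one_div_cancel hc0.ne',
        ENNReal.ofReal_one]
    · exact (integrableOn_Ioi_rpow_of_lt (by linarith) one_pos).const_mul c
    · filter_upwards [ae_restrict_mem measurableSet_Ioi] with t ht
      have : (0 : ℝ) < t := one_pos.trans ht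
      simp only [Pi.zero_apply]; positivity
  have hkm : Measurable fun q : Rn n × ℝ => ENNReal.ofReal (q.2 ^ a) * h (q.2 • q.1) := by
    fun_prop
  have hrepr : ∀ x : Rn n, ∫⁻ s in Set.Ioi (1 : ℝ), h (s • x) =
      ENNReal.ofReal c⁻¹ * ∫⁻ t, ENNReal.ofReal (t ^ a) * h (t • x) ∂μ := fun x => by
    rw [hμ, lintegral_withDensity_eq_lintegral_mul _ hwm
      (show Measurable fun t : ℝ => ENNReal.ofReal (t ^ a) * h (t • x) by fun_prop),
      ← lintegral_const_mul _ (by fun_prop)]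
    refine setLIntegral_congr_fun measurableSet_Ioi fun t ht => ?_
    have ht0 : (0 : ℝ) < t := one_pos.trans ht
    simp only [Pi.mul_apply, hw]
    rw [← mul_assoc, ← mul_assoc, ← ENNReal.ofReal_mul (by positivity),
      ← ENNReal.ofReal_mul (by positivity), Real.rpow_neg ht0.le]
    have : c⁻¹ * (c * (t ^ a)⁻¹) * t ^ a = 1 := by
      have := (Real.rpow_pos_of_pos ht0 a).ne'
      field_simp
    rw [this, ENNReal.ofReal_one, one_mul]
  calc ∫⁻ x, (∫⁻ s in Set.Ioi (1 : ℝ), h (s • x)) ^ p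
      ≤ ∫⁻ x, ENNReal.ofReal c⁻¹ ^ p *
          ∫⁻ t, (ENNReal.ofReal (t ^ a) * h (t • x)) ^ p ∂μ := by
        refine lintegral_mono fun x => ?_
        simp only [hrepr x]
        rw [ENNReal.mul_rpow_of_nonneg _ _ hp0.le]
        gcongr
        exact rpow_lintegral_le_lintegral_rpow μ
          (hkm.comp (measurable_prodMk_left (x := x))).aemeasurable hp1
    _ = ENNReal.ofReal c⁻¹ ^ p *
          ∫⁻ t, (∫⁻ x, (ENNReal.ofReal (t ^ a) * h (t • x)) ^ p) ∂μ := by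
        rw [lintegral_const_mul _ (hkm.pow_const p).lintegral_prod_right',
          lintegral_lintegral_swap (hkm.pow_const p).aemeasurable]
    _ = ENNReal.ofReal c⁻¹ ^ p * ∫⁻ _, (∫⁻ x, h x ^ p) ∂μ := by
        congr 1
        refine lintegral_congr_ae ?_
        filter_upwards [hae] with t ht
        have ht0 : (0 : ℝ) < t := one_pos.trans ht
        simp only [ENNReal.mul_rpow_of_nonneg _ _ hp0.le]
        rw [lintegral_const_mul _ (by fun_prop),
          lintegral_comp_smul_Rn (fun x => h x ^ p) ht0, ← mul_assoc,
          ENNReal.ofReal_rpow_of_pos (by positivity), ← Real.rpow_mul ht0.le, ha,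
          div_mul_cancel₀ _ hp0.ne', Real.rpow_natCast, ← ENNReal.ofReal_mul (by positivity),
          mul_inv_cancel₀ (by positivity), ENNReal.ofReal_one, one_mul]
    _ = _ := by rw [lintegral_const, measure_univ, mul_one, hcinv]

theorem continuous_gradient {n : ℕ} {v : Rn n → ℝ} (hv : ContDiff ℝ 1 v) :
    Continuous (gradient v) :=
  (InnerProductSpace.toDual ℝ (Rn n)).symm.continuous.comp (hv.continuous_fderiv one_ne_zero)

theorem measurable_radial_gradient {n : ℕ} {v : Rn n → ℝ} (hv : ContDiff ℝ 1 v) :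
    Measurable fun x : Rn n => inner ℝ (‖x‖⁻¹ • x) (gradient v x) := by
  have := (continuous_gradient hv).measurable
  fun_prop

namespace IsRadialProjection

variable {n : ℕ} {Ω : Set (Rn n)} {f : Rn n → Rn n}

/-- The fundamental theorem of calculus along the segment from `x` to `f x`. -/
theorem enorm_sub_div_le (h : IsRadialProjection Ω f) {v : Rn n → ℝ} (hv : ContDiff ℝ 1 v)
    {x : Rn n} (hx : x ∈ Ω) (hx0 : x ≠ 0) :
    ‖v x - v (f x)‖ₑ / ‖x‖ₑ ≤ ∫⁻ s in Set.Ioi (1 : ℝ),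
      Ω.indicator (fun z => ‖inner ℝ (‖z‖⁻¹ • z) (gradient v z)‖ₑ) (s • x) := by
  obtain ⟨-, t, ht, hft⟩ := h.exists_smul x hx hx0
  have hxn : 0 < ‖x‖ := norm_pos_iff.2 hx0
  refine ENNReal.div_le_of_le_mul' ?_
  have hder : ∀ s : ℝ, HasDerivAt (fun s : ℝ => v (s • x)) (fderiv ℝ v (s • x) x) s := fun s => by
    have := ((hv.differentiable one_ne_zero) (s • x)).hasFDerivAt.comp_hasDerivAt s
      ((hasDerivAt_id s).smul_const x)
    rw [one_smul] at this
    exact this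
  have hcont : Continuous fun s : ℝ => fderiv ℝ v (s • x) x :=
    ((hv.continuous_fderiv one_ne_zero).comp
      (by fun_prop : Continuous fun s : ℝ => s • x)).clm_apply continuous_const
  have hftc : v (f x) - v x = ∫ s in (1 : ℝ)..t, fderiv ℝ v (s • x) x := by
    rw [intervalIntegral.integral_eq_sub_of_hasDerivAt (fun s _ => hder s)
      (hcont.intervalIntegrable _ _), one_smul, hft]
  rw [← enorm_neg, neg_sub, hftc, intervalIntegral.integral_of_le ht.le,
    integral_Ioc_eq_integral_Ioo]
  refine (enorm_integral_le_lintegral_enorm _).trans ?_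
  rw [← lintegral_const_mul' _ _ enorm_ne_top]
  refine (setLIntegral_mono_ae' measurableSet_Ioo (ae_of_all _ fun s hs => ?_)).trans
    (lintegral_mono_set Set.Ioo_subset_Ioi_self)
  have hs0 : 0 < s := one_pos.trans hs.1
  rw [Set.indicator_of_mem (h.smul_mem_of_eq hx hx0 hft hs0 hs.2), ← enorm_norm x,
    ← enorm_mul, real_inner_comm, inner_gradient_left, map_smul, map_smul, norm_smul,
    Real.norm_of_nonneg hs0.le, smul_eq_mul, smul_eq_mul]
  refine le_of_eq (congrArg _ ?_)
  field_simp

/-- The Hardy inequality with boundary values subtracted, for `C¹` functions. -/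
theorem hardy_of_contDiff [NeZero n] (h : IsRadialProjection Ω f) {p : ℝ} (hp1 : 1 ≤ p)
    (hpn : p < n) {v : Rn n → ℝ} (hv : ContDiff ℝ 1 v) :
    ∫⁻ x in Ω, (‖v x - v (f x)‖ₑ / ‖x‖ₑ) ^ p ≤ ENNReal.ofReal (p / (n - p)) ^ p *
      ∫⁻ x in Ω, ‖inner ℝ (‖x‖⁻¹ • x) (gradient v x)‖ₑ ^ p := by
  have hp0 : 0 < p := by linarith
  have hm := h.isOpen.measurableSet
  set H : Rn n → ℝ≥0∞ := Ω.indicator (fun z => ‖inner ℝ (‖z‖⁻¹ • z) (gradient v z)‖ₑ) with hH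
  have hHm : Measurable H := (measurable_radial_gradient hv).enorm.indicator hm
  calc ∫⁻ x in Ω, (‖v x - v (f x)‖ₑ / ‖x‖ₑ) ^ p
      ≤ ∫⁻ x in Ω, (∫⁻ s in Set.Ioi (1 : ℝ), H (s • x)) ^ p := by
        refine lintegral_mono_ae ?_
        filter_upwards [h.ae_mem_punctured] with x hx
        exact ENNReal.rpow_le_rpow (h.enorm_sub_div_le hv hx.1 hx.2) hp0.le
    _ ≤ ∫⁻ x, (∫⁻ s in Set.Ioi (1 : ℝ), H (s • x)) ^ p := setLIntegral_le_lintegral _ _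
    _ ≤ _ := lintegral_rpow_lintegral_dilation_le hp1 hpn hHm
    _ = _ := by
        rw [← lintegral_indicator hm]
        congr 2 with x
        by_cases hx : x ∈ Ω <;> simp [hH, hx, hp0]

end IsRadialProjection

/-! ### Surface measure and the image of Lebesgue measure under the radial projection -/

namespace IsRadialProjection

variable {n : ℕ} {Ω : Set (Rn n)} {f : Rn n → Rn n}

theorem isFiniteMeasure_volume_restrict (h : IsRadialProjection Ω f) :
    IsFiniteMeasure (volume.restrict Ω) :=
  _root_.MeasureTheory.isFiniteMeasure_restrict.2 h.isBounded.measure_lt_top.ne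

/-- The cone `f ⁻¹' closedBall y r` over a small boundary ball has volume at least a multiple
of `r ^ (n - 1)`. As `f` is Lipschitz on an annulus around the origin, the cone contains
about `1 / r` disjoint balls of radius comparable to `r`, centred on the segment from `0`
to `y`. -/
theorem exists_le_map_closedBall [NeZero n] (h : IsRadialProjection Ω f) :
    ∃ c r₀ : ℝ, 0 < c ∧ 0 < r₀ ∧ ∀ y ∈ frontier Ω, ∀ r, 0 < r → r ≤ r₀ →
      ENNReal.ofReal (c * r ^ ((n : ℝ) - 1)) ≤
        (volume.restrict Ω).map f (Metric.closedBall y r) := by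
  obtain ⟨δ, hδ, hδΩ⟩ := Metric.nhds_basis_closedBall.mem_iff.1 (h.isOpen.mem_nhds h.zero_mem)
  set ε := δ / 3 with hε
  have hε0 : 0 < ε := by positivity
  set K : Set (Rn n) := Metric.closedBall 0 δ \ Metric.ball 0 (ε / 2) with hK
  have hKc : IsCompact K := (ProperSpace.isCompact_closedBall 0 δ).diff Metric.isOpen_ball
  have hKΩ : K ⊆ Ω \ {0} := fun x hx => ⟨hδΩ hx.1, fun hx0 => hx.2 (by
    rw [Set.mem_singleton_iff.1 hx0]; exact Metric.mem_ball_self (by positivity))⟩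
  obtain ⟨L₀, hL₀⟩ := hKc.exists_bound_of_continuousOn
    ((h.contDiffOn.continuousOn_fderiv_of_isOpen h.isOpen_punctured le_rfl).mono hKΩ)
  set L := max L₀ 1 with hL
  have hL1 : 1 ≤ L := le_max_right _ _
  have hL0 : 0 < L := by linarith
  set κ := (volume (Metric.ball (0 : Rn n) 1)).toReal with hκ
  have hκ0 : 0 < κ := ENNReal.toReal_pos (Metric.measure_ball_pos _ _ one_pos).ne'
    measure_ball_lt_top.ne
  refine ⟨ε * κ / 4 * (L⁻¹) ^ ((n : ℝ) - 1), ε / 4, by positivity, by positivity, ?_⟩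
  intro y hy r hr hrε
  set ρ := r / L with hρ
  have hρ0 : 0 < ρ := by positivity
  have hρε : ρ ≤ ε / 4 := (div_le_self hr.le hL1).trans hrε
  have hy0 := h.ne_zero_of_mem_frontier hy
  have hyn : 0 < ‖y‖ := norm_pos_iff.2 hy0
  have hyδ : δ < ‖y‖ := by
    by_contra! hc
    have : y ∈ Ω := hδΩ (by simpa using hc)
    rw [h.isOpen.frontier_eq] at hy
    exact hy.2 this
  -- `N` consecutive balls of radius `ρ` fit between distance `ε` and `2 ε` from the origin
  set N := ⌊ε / (2 * ρ)⌋₊ with hN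
  have hNlo : ε / (4 * ρ) ≤ N := by
    have h1 : ε / (2 * ρ) - 1 < N := Nat.sub_one_lt_floor _
    have h2 : ε / (2 * ρ) = 2 * (ε / (4 * ρ)) := by field_simp; norm_num
    have h3 : 1 ≤ ε / (4 * ρ) := by rw [one_le_div (by positivity)]; linarith
    linarith
  have hNhi : 2 * ρ * N ≤ ε := by
    have : (N : ℝ) ≤ ε / (2 * ρ) := Nat.floor_le (by positivity)
    rwa [le_div_iff₀ (by positivity), mul_comm] at this
  set s : ℕ → ℝ := fun j => (ε + 2 * ρ * j) / ‖y‖ with hs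
  have hs_norm : ∀ j, ‖s j • y‖ = ε + 2 * ρ * j := fun j => by
    rw [norm_smul, Real.norm_of_nonneg (by positivity), div_mul_cancel₀ _ hyn.ne']
  have hjN : ∀ j ∈ Finset.range N, 2 * ρ * (j : ℝ) ≤ ε := fun j hj => by
    refine le_trans ?_ hNhi
    gcongr
    exact (Finset.mem_range.1 hj).le
  have hballK : ∀ j ∈ Finset.range N, Metric.ball (s j • y) ρ ⊆ K := fun j hj x hx => by
    have h1 := hjN j hj
    have h2 := hs_norm j
    have h3 : 0 ≤ 2 * ρ * (j : ℝ) := by positivity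
    rw [mem_ball_iff_norm] at hx
    have h4 := norm_sub_norm_le x (s j • y)
    have h5 := norm_sub_norm_le (s j • y) x
    rw [norm_sub_rev] at h5
    refine ⟨?_, ?_⟩
    · rw [mem_closedBall_zero_iff]; linarith
    · rw [mem_ball_zero_iff, not_lt]; linarith
  have hballf : ∀ j ∈ Finset.range N, Metric.ball (s j • y) ρ ⊆
      f ⁻¹' Metric.closedBall y r := fun j hj x hx => by
    have hfs : f (s j • y) = y := (h.smul_frontier y hy (s j) (by positivity) (by
      rw [div_lt_one hyn]
      linarith [hjN j hj])).2
    have := (convex_ball (s j • y) ρ).norm_image_sub_le_of_norm_fderiv_le (𝕜 := ℝ) (f := f) (C := L)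
      (fun z hz => (h.contDiffOn.differentiableOn one_ne_zero).differentiableAt
        (h.isOpen_punctured.mem_nhds (hKΩ (hballK j hj hz))))
      (fun z hz => (hL₀ z (hballK j hj hz)).trans (le_max_left _ _))
      (Metric.mem_ball_self hρ0) hx
    rw [Set.mem_preimage, mem_closedBall_iff_norm, ← hfs]
    refine this.trans ?_
    rw [mem_ball_iff_norm] at hx
    calc L * ‖x - s j • y‖ ≤ L * ρ := by gcongr
      _ = r := mul_div_cancel₀ _ hL0.ne'
  have hdisj : Set.PairwiseDisjoint (Finset.range N : Set ℕ)
      fun j => Metric.ball (s j • y) ρ := fun i _ j _ hij => by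
    refine Metric.ball_disjoint_ball ?_
    rw [dist_eq_norm, ← sub_smul, norm_smul, hs]
    simp only
    rw [← sub_div, norm_div, norm_norm, div_mul_cancel₀ _ hyn.ne', add_sub_add_left_eq_sub,
      ← mul_sub, norm_mul, Real.norm_of_nonneg (by positivity)]
    have : (1 : ℝ) ≤ ‖(i : ℝ) - j‖ := by
      have h1 : (1 : ℤ) ≤ |(i : ℤ) - j| := Int.one_le_abs (sub_ne_zero.2 (by exact_mod_cast hij))
      rw [Real.norm_eq_abs]
      exact_mod_cast h1
    nlinarith
  calc ENNReal.ofReal (ε * κ / 4 * (L⁻¹) ^ ((n : ℝ) - 1) * r ^ ((n : ℝ) - 1))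
      = ENNReal.ofReal (ε / (4 * ρ) * (ρ ^ n * κ)) := by
        congr 1
        rw [mul_assoc, ← Real.mul_rpow (by positivity) hr.le, inv_mul_eq_div, ← hρ,
          Real.rpow_sub hρ0, Real.rpow_natCast, Real.rpow_one]
        field_simp
    _ ≤ ENNReal.ofReal (N * (ρ ^ n * κ)) := by gcongr
    _ = ∑ j ∈ Finset.range N, volume (Metric.ball (s j • y) ρ) := by
        simp only [Measure.addHaar_ball _ _ hρ0.le, finrank_euclideanSpace_fin]
        rw [Finset.sum_const, Finset.card_range, nsmul_eq_mul,
          ENNReal.ofReal_mul (Nat.cast_nonneg _), ENNReal.ofReal_mul (by positivity), hκ,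
          ENNReal.ofReal_toReal measure_ball_lt_top.ne, ENNReal.ofReal_natCast]
    _ = volume (⋃ j ∈ Finset.range N, Metric.ball (s j • y) ρ) :=
        (measure_biUnion_finset hdisj fun _ _ => Metric.isOpen_ball.measurableSet).symm
    _ ≤ volume (f ⁻¹' Metric.closedBall y r ∩ Ω) := by
        refine measure_mono (Set.iUnion₂_subset fun j hj => ?_)
        exact Set.subset_inter (hballf j hj) ((hballK j hj).trans (hKΩ.trans Set.sdiff_subset))
    _ = _ := by
        rw [Measure.map_apply_of_aemeasurable h.aemeasurable
            Metric.isClosed_closedBall.measurableSet,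
          Measure.restrict_apply' h.isOpen.measurableSet]

/-- The cone `f ⁻¹' closedBall y d` lies in the `d`-neighbourhood of the segment from `0` to `y`,
so its volume is at most a multiple of `d ^ (n - 1)`. -/
theorem exists_map_closedBall_le [NeZero n] (h : IsRadialProjection Ω f) :
    ∃ C : ℝ, 0 < C ∧ ∀ y : Rn n, ∀ d, 0 < d → d ≤ 1 →
      (volume.restrict Ω).map f (Metric.closedBall y d) ≤
        ENNReal.ofReal (C * d ^ ((n : ℝ) - 1)) := by
  obtain ⟨M, hM0, hM⟩ := h.isBounded.closure.subset_closedBall_lt 0 (0 : Rn n)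
  set κ := (volume (Metric.ball (0 : Rn n) 1)).toReal with hκ
  have hκ0 : 0 < κ := ENNReal.toReal_pos (Metric.measure_ball_pos _ _ one_pos).ne'
    measure_ball_lt_top.ne
  refine ⟨(M + 3) * 2 ^ n * κ, by positivity, fun y d hd hd1 => ?_⟩
  -- for `‖y‖ ≤ M + 1`, consecutive points `(j / N) • y` are at distance at most `d`
  set N := ⌈(M + 1) / d⌉₊ with hN
  have hNlo : (M + 1) / d ≤ N := Nat.le_ceil _
  have hN0 : (0 : ℝ) < N := lt_of_lt_of_le (by positivity) hNlo
  have hNhi : (N : ℝ) + 1 ≤ (M + 3) / d := by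
    have h1 : (N : ℝ) < (M + 1) / d + 1 := Nat.ceil_lt_add_one (by positivity)
    have h2 : (M + 3) / d = (M + 1) / d + 2 * (1 / d) := by field_simp; ring
    have h3 : 1 ≤ 1 / d := by rw [one_le_div hd]; exact hd1
    linarith
  have hcov : f ⁻¹' Metric.closedBall y d ∩ (Ω \ {0}) ⊆
      ⋃ j ∈ Finset.range (N + 1), Metric.closedBall (((j : ℝ) / N) • y) (2 * d) := by
    rintro x ⟨hxy, hx, hx0⟩
    obtain ⟨hfr, t, ht, hft⟩ := h.exists_smul x hx hx0
    have ht0 : 0 < t := by linarith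
    have hfM : ‖f x‖ ≤ M := by simpa using hM (frontier_subset_closure hfr)
    rw [Set.mem_preimage, mem_closedBall_iff_norm] at hxy
    have hyM : ‖y‖ ≤ M + 1 := by
      have := norm_sub_norm_le y (f x)
      rw [norm_sub_rev] at this
      linarith
    set s := t⁻¹ with hs
    have hs0 : 0 < s := by positivity
    have hs1 : s < 1 := inv_lt_one_of_one_lt₀ ht
    have hxs : x = s • f x := by rw [hft, smul_smul, hs, inv_mul_cancel₀ ht0.ne', one_smul]
    have h1 : ‖x - s • y‖ ≤ d := by
      rw [show x - s • y = s • (f x - y) by rw [smul_sub, ← hxs], norm_smul,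
        Real.norm_of_nonneg hs0.le]
      exact (mul_le_of_le_one_left (norm_nonneg _) hs1.le).trans hxy
    set j := ⌊s * N⌋₊ with hj
    have hjlo : (j : ℝ) ≤ s * N := Nat.floor_le (by positivity)
    have hjhi : s * N < j + 1 := Nat.lt_floor_add_one _
    have h2 : ‖s • y - ((j : ℝ) / N) • y‖ ≤ d := by
      rw [← sub_smul, norm_smul, Real.norm_of_nonneg
        (by rw [sub_nonneg, div_le_iff₀ hN0]; exact hjlo)]
      have h3 : s - j / N ≤ 1 / N := by
        rw [sub_le_iff_le_add, ← add_div, le_div_iff₀ hN0]; linarith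
      calc (s - j / N) * ‖y‖ ≤ 1 / N * (M + 1) := by gcongr
        _ ≤ d := by
          rw [div_mul_eq_mul_div, one_mul, div_le_iff₀ hN0]
          rwa [div_le_iff₀ hd, mul_comm] at hNlo
    refine Set.mem_iUnion₂.2 ⟨j, Finset.mem_range.2 (Nat.lt_succ_of_le ?_), ?_⟩
    · have : (j : ℝ) ≤ N := hjlo.trans (mul_le_of_le_one_left hN0.le hs1.le)
      exact_mod_cast this
    · rw [mem_closedBall_iff_norm]
      calc _ ≤ ‖x - s • y‖ + ‖s • y - ((j : ℝ) / N) • y‖ := norm_sub_le_norm_sub_add_norm_sub _ _ _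
        _ ≤ 2 * d := by linarith
  have hr : volume.restrict Ω = volume.restrict (Ω \ {0}) :=
    Measure.restrict_congr_set ((sdiff_null_ae_eq_self (by simp)).symm)
  calc (volume.restrict Ω).map f (Metric.closedBall y d)
      = volume (f ⁻¹' Metric.closedBall y d ∩ (Ω \ {0})) := by
        rw [Measure.map_apply_of_aemeasurable h.aemeasurable
            Metric.isClosed_closedBall.measurableSet,
          hr, Measure.restrict_apply' h.isOpen_punctured.measurableSet]
    _ ≤ ∑ j ∈ Finset.range (N + 1),
          volume (Metric.closedBall (((j : ℝ) / N) • y) (2 * d)) :=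
        (measure_mono hcov).trans (measure_biUnion_finset_le _ _)
    _ = ENNReal.ofReal ((N + 1) * ((2 * d) ^ n * κ)) := by
        simp only [Measure.addHaar_closedBall _ _ (by positivity : 0 ≤ 2 * d),
          finrank_euclideanSpace_fin]
        rw [Finset.sum_const, Finset.card_range, nsmul_eq_mul,
          ENNReal.ofReal_mul (by positivity), ENNReal.ofReal_mul (by positivity), hκ,
          ENNReal.ofReal_toReal measure_ball_lt_top.ne]
        congr 1
        rw [show ((N : ℝ) + 1) = ((N + 1 : ℕ) : ℝ) by push_cast; rfl, ENNReal.ofReal_natCast]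
    _ ≤ ENNReal.ofReal ((M + 3) / d * ((2 * d) ^ n * κ)) := by gcongr
    _ = _ := by
        congr 1
        rw [Real.rpow_sub hd, Real.rpow_natCast, Real.rpow_one, mul_pow]
        field_simp

theorem ae_map_mem_frontier [NeZero n] (h : IsRadialProjection Ω f) :
    ∀ᵐ y ∂((volume.restrict Ω).map f), y ∈ frontier Ω := by
  refine (ae_map_iff (p := fun y => y ∈ frontier Ω) h.aemeasurable
    isClosed_frontier.measurableSet).2 ?_
  filter_upwards [h.ae_mem_punctured] with x hx using (h.exists_smul x hx.1 hx.2).1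

/-- Surface measure is dominated by the image of Lebesgue measure under `f`. -/
theorem exists_surfaceMeasure_le (h : IsRadialProjection Ω f) (hn : 2 ≤ n) :
    ∃ C : ℝ≥0∞, C ≠ ⊤ ∧ surfaceMeasure Ω ≤ C • (volume.restrict Ω).map f := by
  have : NeZero n := ⟨by omega⟩
  have hd : (0 : ℝ) < n - 1 := by
    have : (2 : ℝ) ≤ n := by exact_mod_cast hn
    linarith
  have := h.isFiniteMeasure_volume_restrict
  obtain ⟨c, r₀, hc, hr₀, hball⟩ := h.exists_le_map_closedBall
  refine ⟨ENNReal.ofReal (10 ^ ((n : ℝ) - 1) / c), ENNReal.ofReal_ne_top,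
    Measure.le_iff.2 fun A hA => ?_⟩
  rw [surfaceMeasure, Measure.restrict_apply hA]
  refine (hausdorffMeasure_le_of_le_measure_closedBall ((volume.restrict Ω).map f) hd hc hr₀
    fun x hx => hball x hx.2).trans ?_
  rw [Measure.smul_apply, smul_eq_mul]
  gcongr
  exact Set.inter_subset_left

/-- The radial projection pulls back surface null sets to Lebesgue null sets. -/
theorem map_absolutelyContinuous (h : IsRadialProjection Ω f) (hn : 2 ≤ n) :
    (volume.restrict Ω).map f ≪ surfaceMeasure Ω := by
  have : NeZero n := ⟨by omega⟩
  have hd : (0 : ℝ) < n - 1 := by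
    have : (2 : ℝ) ≤ n := by exact_mod_cast hn
    linarith
  set σ := (volume.restrict Ω).map f with hσ
  obtain ⟨C, hC, hball⟩ := h.exists_map_closedBall_le
  have hCinv : ENNReal.ofReal C ≠ 0 := by simpa using hC
  have hle : (ENNReal.ofReal C)⁻¹ • σ ≤ μH[(n : ℝ) - 1] := by
    refine Measure.le_hausdorffMeasure _ _ (1 / 2) (by norm_num) fun s hs => ?_
    rcases s.eq_empty_or_nonempty with rfl | ⟨y, hy⟩
    · simp
    have hfin : Metric.ediam s ≠ ⊤ := (hs.trans_lt (by norm_num)).ne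
    set δ := Metric.diam s with hδ
    have hδ2 : δ ≤ 1 / 2 := by
      have := ENNReal.toReal_mono (by norm_num) hs
      simpa [hδ, Metric.diam] using this
    -- the cone bound needs `d > 0`; a set of diameter `δ = 0` is reached in the limit `d → δ`
    have hbd : ∀ d, δ < d → d ≤ 1 → σ s ≤ ENNReal.ofReal (C * d ^ ((n : ℝ) - 1)) :=
      fun d hd hd1 => by
        refine (measure_mono fun x hx => ?_).trans
          (hball y d (Metric.diam_nonneg.trans_lt hd) hd1)
        exact (Metric.dist_le_diam_of_mem' hfin hx hy).trans hd.le
    have hlim : Tendsto (fun d : ℝ => ENNReal.ofReal (C * d ^ ((n : ℝ) - 1))) (𝓝[>] δ)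
        (𝓝 (ENNReal.ofReal (C * δ ^ ((n : ℝ) - 1)))) := by
      refine ENNReal.tendsto_ofReal (Tendsto.mono_left ?_ nhdsWithin_le_nhds)
      exact ((Real.continuous_rpow_const hd.le).tendsto δ).const_mul C
    have hfinal : σ s ≤ ENNReal.ofReal (C * δ ^ ((n : ℝ) - 1)) := by
      refine ge_of_tendsto hlim ?_
      filter_upwards [Ioc_mem_nhdsGT (show δ < 1 by linarith)] with d hd using hbd d hd.1 hd.2
    rw [Measure.smul_apply, smul_eq_mul]
    calc _ ≤ (ENNReal.ofReal C)⁻¹ * ENNReal.ofReal (C * δ ^ ((n : ℝ) - 1)) := by gcongr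
      _ = ENNReal.ofReal δ ^ ((n : ℝ) - 1) := by
        rw [ENNReal.ofReal_mul hC.le, ← mul_assoc,
          ENNReal.inv_mul_cancel hCinv ENNReal.ofReal_ne_top, one_mul,
          ENNReal.ofReal_rpow_of_nonneg Metric.diam_nonneg hd.le]
      _ = _ := by rw [hδ, Metric.diam, ENNReal.ofReal_toReal hfin]
  intro A hA
  rw [surfaceMeasure, Measure.restrict_apply' isClosed_frontier.measurableSet] at hA
  have h1 : σ (A ∩ frontier Ω) = 0 := by
    have := (hle (A ∩ frontier Ω)).trans_eq hA
    simpa [ENNReal.ofReal_ne_top] using this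
  exact measure_mono_null (fun x hx => (em (x ∈ frontier Ω)).imp (fun h' => ⟨hx, h'⟩) id)
    (measure_union_null h1 (ae_iff.1 h.ae_map_mem_frontier))

end IsRadialProjection

/-! ### The trace inequality and the Hardy inequality in the Sobolev space -/

theorem gradient_sub {n : ℕ} {v w : Rn n → ℝ} (hv : ContDiff ℝ 1 v) (hw : ContDiff ℝ 1 w)
    (x : Rn n) : gradient (fun x => v x - w x) x = gradient v x - gradient w x := by
  simp only [gradient]
  rw [fderiv_fun_sub (hv.differentiable one_ne_zero x) (hw.differentiable one_ne_zero x), map_sub]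

theorem norm_inner_unit_le {n : ℕ} (x z : Rn n) : ‖inner ℝ (‖x‖⁻¹ • x) z‖ ≤ ‖z‖ := by
  refine (norm_inner_le_norm _ _).trans (mul_le_of_le_one_left (norm_nonneg _) ?_)
  rw [norm_smul, norm_inv, norm_norm]
  exact inv_mul_le_one

namespace IsRadialProjection

variable {n : ℕ} {Ω : Set (Rn n)} {f : Rn n → Rn n}

theorem eLpNorm_sub_div_le [NeZero n] (h : IsRadialProjection Ω f) {p : ℝ} (hp1 : 1 ≤ p)
    (hpn : p < n) {v : Rn n → ℝ} (hv : ContDiff ℝ 1 v) :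
    eLpNorm (fun x => (v x - v (f x)) / ‖x‖) (ENNReal.ofReal p) (volume.restrict Ω) ≤
      ENNReal.ofReal (p / (n - p)) * eLpNorm (fun x => inner ℝ (‖x‖⁻¹ • x) (gradient v x))
        (ENNReal.ofReal p) (volume.restrict Ω) := by
  have hp0 : 0 < p := by linarith
  have hP0 : ENNReal.ofReal p ≠ 0 := by simpa using hp0
  rw [eLpNorm_eq_lintegral_rpow_enorm_toReal hP0 ENNReal.ofReal_ne_top,
    eLpNorm_eq_lintegral_rpow_enorm_toReal hP0 ENNReal.ofReal_ne_top, ENNReal.toReal_ofReal hp0.le]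
  have hH := h.hardy_of_contDiff hp1 hpn hv
  have hL : ∫⁻ x in Ω, ‖(v x - v (f x)) / ‖x‖‖ₑ ^ p =
      ∫⁻ x in Ω, (‖v x - v (f x)‖ₑ / ‖x‖ₑ) ^ p := by
    refine lintegral_congr_ae ?_
    filter_upwards [h.ae_mem_punctured] with x hx
    rw [div_eq_mul_inv, enorm_mul, enorm_inv (norm_ne_zero_iff.2 hx.2), enorm_norm, div_eq_mul_inv]
  rw [hL]
  calc _ ≤ _ := ENNReal.rpow_le_rpow hH (by positivity : 0 ≤ 1 / p)
    _ = _ := by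
      rw [ENNReal.mul_rpow_of_nonneg _ _ (by positivity), ← ENNReal.rpow_mul,
        mul_one_div_cancel hp0.ne', ENNReal.rpow_one]

theorem ae_comp_of_ae_surfaceMeasure (h : IsRadialProjection Ω f) (hn : 2 ≤ n) {q : Rn n → Prop}
    (hq : ∀ᵐ y ∂(surfaceMeasure Ω), q y) : ∀ᵐ x ∂(volume.restrict Ω), q (f x) := by
  have : NeZero n := ⟨by omega⟩
  exact ae_of_ae_map h.aemeasurable ((h.map_absolutelyContinuous hn).ae_le hq)

/-- The trace inequality. The surface `L^p` norm of `v` is controlled by the `L^p(Ω)` norm of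
`v ∘ f`, and the Hardy inequality bounds `v - v ∘ f`. -/
theorem exists_eLpNorm_surfaceMeasure_le (h : IsRadialProjection Ω f) (hn : 2 ≤ n) {p : ℝ}
    (hp1 : 1 ≤ p) (hpn : p < n) :
    ∃ C : ℝ≥0∞, C ≠ ⊤ ∧ ∀ v : Rn n → ℝ, ContDiff ℝ 1 v →
      eLpNorm v (ENNReal.ofReal p) (surfaceMeasure Ω) ≤
        C * (eLpNorm v (ENNReal.ofReal p) (volume.restrict Ω) +
          eLpNorm (gradient v) (ENNReal.ofReal p) (volume.restrict Ω)) := by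
  have : NeZero n := ⟨by omega⟩
  have hp0 : 0 < p := by linarith
  have hP1 : 1 ≤ ENNReal.ofReal p := by simpa using hp1
  obtain ⟨C, hC, hle⟩ := h.exists_surfaceMeasure_le hn
  obtain ⟨M, hM0, hM⟩ := h.isBounded.subset_closedBall_lt 0 (0 : Rn n)
  set P := ENNReal.ofReal p with hP
  set B : ℝ≥0∞ := ENNReal.ofReal M * ENNReal.ofReal (p / (n - p)) with hB
  have hBt : B ≠ ⊤ := ENNReal.mul_ne_top ENNReal.ofReal_ne_top ENNReal.ofReal_ne_top
  refine ⟨C ^ (1 / P).toReal * (1 + B), ENNReal.mul_ne_top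
    (ENNReal.rpow_ne_top_of_nonneg ENNReal.toReal_nonneg hC)
    (ENNReal.add_ne_top.2 ⟨ENNReal.one_ne_top, hBt⟩), fun v hv => ?_⟩
  have hvf : AEStronglyMeasurable (fun x => v (f x)) (volume.restrict Ω) :=
    (hv.continuous.measurable.comp_aemeasurable h.aemeasurable).aestronglyMeasurable
  have hvm : AEStronglyMeasurable v (volume.restrict Ω) := hv.continuous.aestronglyMeasurable
  have h1 : eLpNorm (fun x => v x - v (f x)) P (volume.restrict Ω) ≤
      B * eLpNorm (gradient v) P (volume.restrict Ω) := by
    calc _ ≤ ENNReal.ofReal M * eLpNorm (fun x => (v x - v (f x)) / ‖x‖) P (volume.restrict Ω) := by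
          refine eLpNorm_le_mul_eLpNorm_of_ae_le_mul ?_ _
          filter_upwards [h.ae_mem_punctured] with x hx
          have hx0 : 0 < ‖x‖ := norm_pos_iff.2 hx.2
          have hxM : ‖x‖ ≤ M := by simpa using hM hx.1
          rw [norm_div, norm_norm, mul_div_assoc', le_div_iff₀ hx0, mul_comm]
          gcongr
      _ ≤ ENNReal.ofReal M * (ENNReal.ofReal (p / (n - p)) *
          eLpNorm (fun x => inner ℝ (‖x‖⁻¹ • x) (gradient v x)) P (volume.restrict Ω)) := by
          gcongr
          exact h.eLpNorm_sub_div_le hp1 hpn hv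
      _ ≤ _ := by
          rw [← mul_assoc]
          gcongr
          exact eLpNorm_mono fun x => norm_inner_unit_le _ _
  have h2 : eLpNorm (fun x => v (f x)) P (volume.restrict Ω) ≤
      eLpNorm v P (volume.restrict Ω) + B * eLpNorm (gradient v) P (volume.restrict Ω) := by
    have : (fun x => v (f x)) = v - fun x => v x - v (f x) := by
      ext x; simp
    rw [this]
    exact (eLpNorm_sub_le hvm (hvm.sub hvf) hP1).trans (add_le_add_right h1 _)
  calc eLpNorm v P (surfaceMeasure Ω)
      ≤ eLpNorm v P (C • (volume.restrict Ω).map f) := eLpNorm_mono_measure _ hle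
    _ = C ^ (1 / P).toReal * eLpNorm (fun x => v (f x)) P (volume.restrict Ω) := by
        rw [eLpNorm_smul_measure_of_ne_top ENNReal.ofReal_ne_top,
          eLpNorm_map_measure hv.continuous.aestronglyMeasurable h.aemeasurable, smul_eq_mul,
          Function.comp_def, ENNReal.toReal_div, ENNReal.toReal_one]
    _ ≤ C ^ (1 / P).toReal * (1 * eLpNorm v P (volume.restrict Ω) +
          B * eLpNorm (gradient v) P (volume.restrict Ω)) := by rw [one_mul]; gcongr
    _ ≤ C ^ (1 / P).toReal * ((1 + B) * eLpNorm v P (volume.restrict Ω) +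
          (1 + B) * eLpNorm (gradient v) P (volume.restrict Ω)) := by
        gcongr
        · exact le_self_add
        · exact le_add_self
    _ = _ := by ring

/-- The Hardy inequality for `u ∈ W^{1,p}(Ω)`, by Fatou's lemma along an approximating sequence
that converges almost everywhere in `Ω` and on `∂Ω`. -/
theorem eLpNorm_sub_trace_div_le (h : IsRadialProjection Ω f) (hn : 2 ≤ n) {p : ℝ} (hp1 : 1 ≤ p)
    (hpn : p < n) {u : Rn n → ℝ} {g : Rn n → Rn n} {T : Rn n → ℝ} (hu : MemW1p Ω p u g)
    (hT : IsTrace Ω p u g T) :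
    eLpNorm (fun x => (u x - T (f x)) / ‖x‖) (ENNReal.ofReal p) (volume.restrict Ω) ≤
      ENNReal.ofReal (p / (n - p)) * eLpNorm (fun x => inner ℝ (‖x‖⁻¹ • x) (g x))
        (ENNReal.ofReal p) (volume.restrict Ω) := by
  have : NeZero n := ⟨by omega⟩
  have hp0 : 0 < p := by linarith
  have hP0 : ENNReal.ofReal p ≠ 0 := by simpa using hp0
  have hP1 : 1 ≤ ENNReal.ofReal p := by simpa using hp1
  obtain ⟨v, hv, hvu, hvg, hvT⟩ := hT.approx
  set P := ENNReal.ofReal p with hP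
  obtain ⟨k₁, hk₁, hae₁⟩ := (tendstoInMeasure_of_tendsto_eLpNorm hP0
    (fun k => (hv k).continuous.aestronglyMeasurable) hu.memLp.1 hvu).exists_seq_tendsto_ae
  obtain ⟨k₂, hk₂, hae₂⟩ := (tendstoInMeasure_of_tendsto_eLpNorm hP0
    (fun k => (hv (k₁ k)).continuous.aestronglyMeasurable) hT.memLp.1
    (hvT.comp hk₁.tendsto_atTop)).exists_seq_tendsto_ae
  set m : ℕ → ℕ := fun i => k₁ (k₂ i) with hm
  have hmt : Tendsto m atTop atTop := hk₁.tendsto_atTop.comp hk₂.tendsto_atTop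
  have hinv : AEStronglyMeasurable (fun x : Rn n => ‖x‖⁻¹) (volume.restrict Ω) :=
    measurable_norm.inv.aestronglyMeasurable
  have hdir : AEStronglyMeasurable (fun x : Rn n => ‖x‖⁻¹ • x) (volume.restrict Ω) :=
    hinv.smul aestronglyMeasurable_id
  have hfatou := Lp.eLpNorm_lim_le_liminf_eLpNorm (p := P) (μ := volume.restrict Ω)
    (f := fun i x => (v (m i) x - v (m i) (f x)) / ‖x‖)
    (fun i => by
      have h1 : AEStronglyMeasurable (fun x => v (m i) (f x)) (volume.restrict Ω) :=
        ((hv (m i)).continuous.measurable.comp_aemeasurable h.aemeasurable).aestronglyMeasurable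
      simp only [div_eq_mul_inv]
      exact ((hv (m i)).continuous.aestronglyMeasurable.sub h1).mul hinv)
    (fun x => (u x - T (f x)) / ‖x‖) (by
      filter_upwards [hae₁, h.ae_comp_of_ae_surfaceMeasure hn hae₂] with x h1 h2
      exact ((h1.comp hk₂.tendsto_atTop).sub h2).div_const _)
  refine hfatou.trans ?_
  have hbound : ∀ i, eLpNorm (fun x => (v (m i) x - v (m i) (f x)) / ‖x‖) P (volume.restrict Ω) ≤
      ENNReal.ofReal (p / (n - p)) * (eLpNorm (fun x => inner ℝ (‖x‖⁻¹ • x) (g x)) P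
        (volume.restrict Ω) +
        eLpNorm (fun x => gradient (v (m i)) x - g x) P (volume.restrict Ω)) := fun i => by
    refine (h.eLpNorm_sub_div_le hp1 hpn (hv (m i))).trans ?_
    gcongr
    have hsplit : (fun x => inner ℝ (‖x‖⁻¹ • x) (gradient (v (m i)) x)) =
        (fun x => inner ℝ (‖x‖⁻¹ • x) (g x)) +
          fun x => inner ℝ (‖x‖⁻¹ • x) (gradient (v (m i)) x - g x) := by
      ext x; simp [inner_sub_right]
    rw [hsplit]
    refine (eLpNorm_add_le (hdir.inner hu.memLp_grad.1) (hdir.inner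
      ((continuous_gradient (hv (m i))).aestronglyMeasurable.sub hu.memLp_grad.1)) hP1).trans ?_
    gcongr
    exact eLpNorm_mono fun x => norm_inner_unit_le _ _
  have hlim : Tendsto (fun i => ENNReal.ofReal (p / (n - p)) *
      (eLpNorm (fun x => inner ℝ (‖x‖⁻¹ • x) (g x)) P (volume.restrict Ω) +
        eLpNorm (fun x => gradient (v (m i)) x - g x) P (volume.restrict Ω))) atTop
      (𝓝 (ENNReal.ofReal (p / (n - p)) *
        (eLpNorm (fun x => inner ℝ (‖x‖⁻¹ • x) (g x)) P (volume.restrict Ω) + 0))) :=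
    ENNReal.Tendsto.const_mul ((hvg.comp hmt).const_add _) (Or.inr ENNReal.ofReal_ne_top)
  rw [add_zero] at hlim
  rw [← hlim.liminf_eq]
  exact liminf_le_liminf (Eventually.of_forall hbound)

theorem memLp_surfaceMeasure_of_contDiff (h : IsRadialProjection Ω f) (hn : 2 ≤ n) {v : Rn n → ℝ}
    (hv : ContDiff ℝ 1 v) (P : ℝ≥0∞) : MemLp v P (surfaceMeasure Ω) := by
  obtain ⟨C, hC, hle⟩ := h.exists_surfaceMeasure_le hn
  have := h.isFiniteMeasure_volume_restrict
  have : IsFiniteMeasure (surfaceMeasure Ω) := by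
    refine ⟨(hle Set.univ).trans_lt ?_⟩
    rw [Measure.smul_apply, smul_eq_mul]
    exact ENNReal.mul_lt_top hC.lt_top (measure_lt_top _ _)
  have hc : IsCompact (frontier Ω) := h.isBounded.isCompact_closure.of_isClosed_subset
    isClosed_frontier frontier_subset_closure
  obtain ⟨M, hM⟩ := hc.exists_bound_of_continuousOn hv.continuous.continuousOn
  exact MemLp.of_bound hv.continuous.aestronglyMeasurable M
    ((ae_restrict_mem isClosed_frontier.measurableSet).mono hM)

/-- A function in `W^{1,p}(Ω)` that is a limit of `C¹` functions has a trace: by the trace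
inequality the boundary values form a Cauchy sequence in `L^p(∂Ω)`. -/
theorem exists_isTrace (h : IsRadialProjection Ω f) (hn : 2 ≤ n) {p : ℝ} (hp1 : 1 ≤ p)
    (hpn : p < n) {u : Rn n → ℝ} {g : Rn n → Rn n} (hu : MemW1p Ω p u g) {v : ℕ → Rn n → ℝ}
    (hv : ∀ k, ContDiff ℝ 1 (v k))
    (hvu : Tendsto (fun k => eLpNorm (fun x => v k x - u x) (ENNReal.ofReal p)
      (volume.restrict Ω)) atTop (𝓝 0))
    (hvg : Tendsto (fun k => eLpNorm (fun x => gradient (v k) x - g x) (ENNReal.ofReal p)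
      (volume.restrict Ω)) atTop (𝓝 0)) :
    ∃ T : Rn n → ℝ, IsTrace Ω p u g T := by
  have hP1 : 1 ≤ ENNReal.ofReal p := by simpa using hp1
  obtain ⟨C, hC, htr⟩ := h.exists_eLpNorm_surfaceMeasure_le hn hp1 hpn
  set P := ENNReal.ofReal p with hP
  have : Fact (1 ≤ P) := ⟨hP1⟩
  have hmem := fun k => h.memLp_surfaceMeasure_of_contDiff hn (hv k) P
  set s : ℕ → ℝ≥0∞ := fun k => C * (eLpNorm (fun x => v k x - u x) P (volume.restrict Ω) +
    eLpNorm (fun x => gradient (v k) x - g x) P (volume.restrict Ω)) with hs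
  have hs0 : Tendsto s atTop (𝓝 0) := by
    have := ENNReal.Tendsto.const_mul (a := C) (hvu.add hvg) (Or.inr hC)
    simpa using this
  have hdist : ∀ k l, edist ((hmem k).toLp _) ((hmem l).toLp _) ≤ s k + s l := fun k l => by
    rw [Lp.edist_toLp_toLp]
    refine (htr _ ((hv k).sub (hv l))).trans ?_
    have e1 : (fun x => v k x - v l x) = (fun x => v k x - u x) - fun x => v l x - u x := by
      ext x; simp
    have e2 : gradient (fun x => v k x - v l x) =
        (fun x => gradient (v k) x - g x) - fun x => gradient (v l) x - g x := by
      ext1 x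
      simp only [Pi.sub_apply, sub_sub_sub_cancel_right]
      exact gradient_sub (hv k) (hv l) x
    have m1 := fun k => (hv k).continuous.aestronglyMeasurable.sub hu.memLp.1
    have m2 := fun k => (continuous_gradient (hv k)).aestronglyMeasurable.sub hu.memLp_grad.1
    calc _ ≤ C * ((eLpNorm (fun x => v k x - u x) P (volume.restrict Ω) +
            eLpNorm (fun x => v l x - u x) P (volume.restrict Ω)) +
          (eLpNorm (fun x => gradient (v k) x - g x) P (volume.restrict Ω) +
            eLpNorm (fun x => gradient (v l) x - g x) P (volume.restrict Ω))) := by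
          gcongr
          · rw [e1]; exact eLpNorm_sub_le (m1 k) (m1 l) hP1
          · rw [e2]; exact eLpNorm_sub_le (m2 k) (m2 l) hP1
      _ = _ := by simp only [hs]; ring
  have hcauchy : CauchySeq fun k => (hmem k).toLp (v k) := by
    refine EMetric.cauchySeq_iff.2 fun ε hε => ?_
    obtain ⟨N, hN⟩ := eventually_atTop.1 (hs0.eventually (gt_mem_nhds (ENNReal.half_pos hε.ne')))
    refine ⟨N, fun k hk l hl => (hdist k l).trans_lt ?_⟩
    calc s k + s l < ε / 2 + ε / 2 := ENNReal.add_lt_add (hN k hk) (hN l hl)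
      _ = ε := ENNReal.add_halves ε
  obtain ⟨T, hT⟩ := cauchySeq_tendsto_of_complete hcauchy
  refine ⟨T, Lp.memLp T, v, hv, hvu, hvg, ?_⟩
  have := (Lp.tendsto_Lp_iff_tendsto_eLpNorm' _ _).1 hT
  refine this.congr fun k => eLpNorm_congr_ae ?_
  filter_upwards [(hmem k).coeFn_toLp] with x hx
  simp [hx]

end IsRadialProjection

/-! ### Approximation by dilation and mollification -/

theorem eLpNorm_comp_dilation_le {n : ℕ} {E : Type*} [NormedAddCommGroup E] {p : ℝ} (hp0 : 0 < p)
    (U : Rn n → E) {l : ℝ} (hl : 1 / 2 ≤ l) (y : Rn n) :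
    eLpNorm (fun x => U (l • (x - y))) (ENNReal.ofReal p) volume ≤
      ENNReal.ofReal (2 ^ n) ^ (1 / p) * eLpNorm U (ENNReal.ofReal p) volume := by
  have hP0 : ENNReal.ofReal p ≠ 0 := by simpa using hp0
  have hl0 : 0 < l := by linarith
  rw [eLpNorm_eq_lintegral_rpow_enorm_toReal hP0 ENNReal.ofReal_ne_top,
    eLpNorm_eq_lintegral_rpow_enorm_toReal hP0 ENNReal.ofReal_ne_top, ENNReal.toReal_ofReal hp0.le,
    ← ENNReal.mul_rpow_of_nonneg _ _ (by positivity)]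
  refine ENNReal.rpow_le_rpow ?_ (by positivity)
  rw [lintegral_sub_right_eq_self (fun x => ‖U (l • x)‖ₑ ^ p),
    lintegral_comp_smul_Rn (fun x => ‖U x‖ₑ ^ p) hl0]
  gcongr
  rw [← inv_pow]
  gcongr
  exact inv_le_of_inv_le₀ (by norm_num) (by linarith)

/-- The affine changes of variables `x ↦ l • (x - y)` act continuously on `L^p` at the
identity `(l, y) = (1, 0)`. -/
theorem exists_eLpNorm_comp_dilation_sub_le {n : ℕ} {E : Type*} [NormedAddCommGroup E]
    [NormedSpace ℝ E] {p : ℝ} (hp1 : 1 ≤ p) {U : Rn n → E} (hUm : StronglyMeasurable U)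
    (hU : MemLp U (ENNReal.ofReal p) volume) {η : ℝ≥0∞} (hη : η ≠ 0) :
    ∃ δ : ℝ, 0 < δ ∧ δ ≤ 1 / 2 ∧ ∀ l : ℝ, 1 - δ ≤ l → l ≤ 1 → ∀ y : Rn n, ‖y‖ ≤ δ →
      eLpNorm (fun x => U (l • (x - y)) - U x) (ENNReal.ofReal p) volume ≤ η := by
  have hp0 : 0 < p := by linarith
  have hP1 : 1 ≤ ENNReal.ofReal p := by simpa using hp1
  set P := ENNReal.ofReal p with hP
  set C := ENNReal.ofReal (2 ^ n) ^ (1 / p) with hC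
  have hCt : C ≠ ⊤ := ENNReal.rpow_ne_top_of_nonneg (by positivity) ENNReal.ofReal_ne_top
  set η' := η / (C + 1 + 1) with hη'
  have hη'0 : η' ≠ 0 := ENNReal.div_ne_zero.2 ⟨hη, by simp [hCt]⟩
  obtain ⟨h, hcs, hUh, hcont, hmem⟩ := hU.exists_hasCompactSupport_eLpNorm_sub_le
    ENNReal.ofReal_ne_top hη'0
  obtain ⟨R, hR0, hR⟩ := hcs.isCompact.isBounded.subset_closedBall_lt 0 (0 : Rn n)
  have hzero : ∀ x : Rn n, R < ‖x‖ → h x = 0 := fun x hx => by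
    by_contra hc
    have := hR (subset_tsupport _ hc)
    rw [mem_closedBall_zero_iff] at this
    linarith
  set S := Metric.closedBall (0 : Rn n) (2 * R + 1) with hS
  have hSfin : volume S ^ (1 / P.toReal) ≠ ⊤ :=
    ENNReal.rpow_ne_top_of_nonneg (by positivity) measure_closedBall_lt_top.ne
  obtain ⟨κ, hκ0, hκ⟩ := ENNReal.exists_nnreal_pos_mul_lt hSfin hη'0
  obtain ⟨δ₁, hδ₁, huc⟩ := Metric.uniformContinuous_iff.1
    (hcs.uniformContinuous_of_continuous hcont) κ hκ0
  refine ⟨min (1 / 2) (δ₁ / (2 * R + 3)), by positivity, min_le_left _ _, ?_⟩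
  intro l hl hl1 y hy
  have hl2 : 1 / 2 ≤ l := by
    have := min_le_left (1 / 2) (δ₁ / (2 * R + 3))
    linarith
  have hl0 : 0 < l := by linarith
  have hy2 : ‖y‖ ≤ 1 / 2 := hy.trans (min_le_left _ _)
  set δ := min (1 / 2) (δ₁ / (2 * R + 3)) with hδ
  have hδ0 : 0 < δ := by positivity
  have hδ' : δ * (2 * R + 3) ≤ δ₁ := by
    rw [← le_div_iff₀ (by positivity)]; exact min_le_right _ _
  have hclose : ∀ x, ‖h (l • (x - y)) - h x‖ ≤ ‖S.indicator (fun _ => (κ : ℝ)) x‖ := fun x => by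
    by_cases hx : x ∈ S
    · rw [Set.indicator_of_mem hx, NNReal.norm_eq, ← dist_eq_norm]
      refine (huc ?_).le
      rw [hS, mem_closedBall_zero_iff] at hx
      rw [dist_eq_norm, show l • (x - y) - x = -((1 - l) • x + l • y) by module, norm_neg]
      calc ‖(1 - l) • x + l • y‖ ≤ (1 - l) * ‖x‖ + l * ‖y‖ := by
            refine (norm_add_le _ _).trans_eq ?_
            rw [norm_smul, norm_smul, Real.norm_of_nonneg (by linarith), Real.norm_of_nonneg hl0.le]
        _ ≤ δ * (2 * R + 1) + 1 * δ := by gcongr; linarith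
        _ < δ * (2 * R + 3) := by linarith
        _ ≤ δ₁ := hδ'
    · rw [hS, mem_closedBall_zero_iff, not_le] at hx
      rw [hzero x (by linarith), hzero (l • (x - y)), sub_zero, norm_zero]
      · exact norm_nonneg _
      · rw [norm_smul, Real.norm_of_nonneg hl0.le]
        have := norm_sub_norm_le x y
        nlinarith
  have h3 : eLpNorm (fun x => h (l • (x - y)) - h x) P volume ≤ η' := by
    refine (eLpNorm_mono hclose).trans ((eLpNorm_indicator_const_le _ _).trans ?_)
    rw [show ‖(κ : ℝ)‖ₑ = κ by simp]
    exact hκ.le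
  have hm1 : AEStronglyMeasurable (fun x => (U - h) (l • (x - y))) volume :=
    ((hUm.sub hcont.stronglyMeasurable).comp_measurable
      (by fun_prop : Measurable fun x : Rn n => l • (x - y))).aestronglyMeasurable
  have hm2 : AEStronglyMeasurable (fun x => h (l • (x - y)) - h x) volume :=
    ((hcont.comp (by fun_prop)).sub hcont).aestronglyMeasurable
  have hm3 : AEStronglyMeasurable (U - h) volume :=
    (hUm.sub hcont.stronglyMeasurable).aestronglyMeasurable
  have hsplit : (fun x => U (l • (x - y)) - U x) =
      ((fun x => (U - h) (l • (x - y))) + fun x => h (l • (x - y)) - h x) - (U - h) := by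
    ext x; simp only [Pi.sub_apply, Pi.add_apply]; abel
  rw [hsplit]
  calc _ ≤ C * η' + η' + η' := by
        refine (eLpNorm_sub_le (hm1.add hm2) hm3 hP1).trans (add_le_add ?_ hUh)
        refine (eLpNorm_add_le hm1 hm2 hP1).trans (add_le_add ?_ h3)
        exact (eLpNorm_comp_dilation_le hp0 (U - h) hl2 y).trans (by gcongr)
    _ = (C + 1 + 1) * η' := by ring
    _ ≤ η := ENNReal.mul_div_le

/-- The mollification by `φ` of the dilate `t ↦ U (l • t)`. For `l < 1` and `φ` supported near the
origin its value at `x ∈ Ω` involves `U` inside `Ω` only, also when `x` is close to `∂Ω`. -/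
noncomputable def dilatedMollification {n : ℕ} {E : Type*} [NormedAddCommGroup E] [NormedSpace ℝ E]
    (φ : Rn n → ℝ) (l : ℝ) (U : Rn n → E) (x : Rn n) : E :=
  ∫ t, φ (x - t) • U (l • t)

theorem dilatedMollification_sub_eq {n : ℕ} {E : Type*} [NormedAddCommGroup E]
    [NormedSpace ℝ E] [CompleteSpace E] {U : Rn n → E} (hUi : Integrable U) {φ : Rn n → ℝ}
    (hφc : Continuous φ) (hφs : HasCompactSupport φ) (hφ1 : ∫ x, φ x = 1) {l : ℝ} (hl : l ≠ 0)
    (x : Rn n) :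
    dilatedMollification φ l U x - U x = ∫ y, φ y • (U (l • (x - y)) - U x) := by
  have hφi : Integrable φ := hφc.integrable_of_hasCompactSupport hφs
  have hW : Integrable fun y => U (l • (x - y)) :=
    (hUi.comp_smul hl).comp_sub_left x
  have hi : Integrable fun y => φ y • U (l • (x - y)) :=
    hW.smul_of_top_right (hφc.memLp_top_of_hasCompactSupport hφs volume)
  have h1 : dilatedMollification φ l U x = ∫ y, φ y • U (l • (x - y)) := by
    have := integral_sub_left_eq_self (fun t => φ (x - t) • U (l • t)) volume x
    simp only [sub_sub_cancel] at this
    rw [dilatedMollification, this]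
  have h2 : (fun y => φ y • (U (l • (x - y)) - U x)) =
      fun y => φ y • U (l • (x - y)) - φ y • U x := funext fun y => smul_sub _ _ _
  rw [h2, integral_sub hi (hφi.smul_const _), integral_smul_const, hφ1, one_smul, h1]

/-- `L^p` distance between `U` and its dilated mollification, by Jensen's inequality for the
probability measure with density `φ`. -/
theorem eLpNorm_dilatedMollification_sub_le {n : ℕ} {E : Type*} [NormedAddCommGroup E]
    [NormedSpace ℝ E] [CompleteSpace E] {p : ℝ} (hp1 : 1 ≤ p) {U : Rn n → E}
    (hUm : StronglyMeasurable U) (hUi : Integrable U) {φ : Rn n → ℝ} (hφc : Continuous φ)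
    (hφs : HasCompactSupport φ) (hφ0 : ∀ x, 0 ≤ φ x) (hφ1 : ∫ x, φ x = 1) {l : ℝ} (hl : 0 < l)
    {η : ℝ≥0∞}
    (hη : ∀ y ∈ Function.support φ,
      eLpNorm (fun x => U (l • (x - y)) - U x) (ENNReal.ofReal p) volume ≤ η) :
    eLpNorm (fun x => dilatedMollification φ l U x - U x) (ENNReal.ofReal p) volume ≤ η := by
  have hp0 : 0 < p := by linarith
  have hP0 : ENNReal.ofReal p ≠ 0 := by simpa using hp0
  set w : Rn n → ℝ≥0∞ := fun y => ENNReal.ofReal (φ y) with hw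
  have hwm : Measurable w := by fun_prop
  set ν : Measure (Rn n) := volume.withDensity w with hν
  have hφi : Integrable φ := hφc.integrable_of_hasCompactSupport hφs
  have : IsProbabilityMeasure ν := by
    refine ⟨?_⟩
    rw [hν, withDensity_apply _ MeasurableSet.univ, Measure.restrict_univ,
      ← ofReal_integral_eq_lintegral_ofReal hφi (ae_of_all _ hφ0), hφ1, ENNReal.ofReal_one]
  have hsupp : ∀ᵐ y ∂ν, y ∈ Function.support φ := by
    rw [hν, ae_withDensity_iff hwm]
    refine ae_of_all _ fun y hy => ?_
    contrapose! hy
    simp [hw, Function.notMem_support.1 hy]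
  have hjoint : Measurable fun q : Rn n × Rn n => ‖U (l • (q.1 - q.2)) - U q.1‖ₑ := by
    refine StronglyMeasurable.enorm (StronglyMeasurable.sub ?_ ?_)
    · exact hUm.comp_measurable (by fun_prop)
    · exact hUm.comp_measurable (by fun_prop)
  have hm : ∀ x, Measurable fun y => ‖U (l • (x - y)) - U x‖ₑ := fun x =>
    StronglyMeasurable.enorm ((hUm.comp_measurable (by fun_prop)).sub stronglyMeasurable_const)
  have hpt : ∀ x, ‖dilatedMollification φ l U x - U x‖ₑ ≤
      ∫⁻ y, ‖U (l • (x - y)) - U x‖ₑ ∂ν := fun x => by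
    have hmul : ∀ y, ‖φ y • (U (l • (x - y)) - U x)‖ₑ = w y * ‖U (l • (x - y)) - U x‖ₑ :=
      fun y => by rw [enorm_smul, Real.enorm_of_nonneg (hφ0 y)]
    calc ‖dilatedMollification φ l U x - U x‖ₑ
        = ‖∫ y, φ y • (U (l • (x - y)) - U x)‖ₑ := by
          rw [dilatedMollification_sub_eq hUi hφc hφs hφ1 hl.ne']
      _ ≤ ∫⁻ y, ‖φ y • (U (l • (x - y)) - U x)‖ₑ := enorm_integral_le_lintegral_enorm _
      _ = ∫⁻ y, w y * ‖U (l • (x - y)) - U x‖ₑ := lintegral_congr hmul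
      _ = ∫⁻ y, ‖U (l • (x - y)) - U x‖ₑ ∂ν :=
          (lintegral_withDensity_eq_lintegral_mul volume hwm (hm x)).symm
  rw [eLpNorm_eq_lintegral_rpow_enorm_toReal hP0 ENNReal.ofReal_ne_top,
    ENNReal.toReal_ofReal hp0.le]
  have hmain : ∫⁻ x, ‖dilatedMollification φ l U x - U x‖ₑ ^ p ≤ η ^ p := by
    calc ∫⁻ x, ‖dilatedMollification φ l U x - U x‖ₑ ^ p
        ≤ ∫⁻ x, ∫⁻ y, ‖U (l • (x - y)) - U x‖ₑ ^ p ∂ν := by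
          refine lintegral_mono fun x => ?_
          exact (ENNReal.rpow_le_rpow (hpt x) hp0.le).trans (rpow_lintegral_le_lintegral_rpow ν
            (hm x).aemeasurable hp1)
      _ = ∫⁻ y, (∫⁻ x, ‖U (l • (x - y)) - U x‖ₑ ^ p) ∂ν :=
          lintegral_lintegral_swap (hjoint.pow_const p).aemeasurable
      _ ≤ ∫⁻ _, η ^ p ∂ν := by
          refine lintegral_mono_ae ?_
          filter_upwards [hsupp] with y hy
          have := ENNReal.rpow_le_rpow (hη y hy) hp0.le
          rwa [eLpNorm_eq_lintegral_rpow_enorm_toReal hP0 ENNReal.ofReal_ne_top,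
            ENNReal.toReal_ofReal hp0.le, ← ENNReal.rpow_mul, one_div_mul_cancel hp0.ne',
            ENNReal.rpow_one] at this
      _ = η ^ p := by rw [lintegral_const, measure_univ, mul_one]
  calc _ ≤ (η ^ p) ^ (1 / p) := ENNReal.rpow_le_rpow hmain (by positivity)
    _ = η := by rw [← ENNReal.rpow_mul, mul_one_div_cancel hp0.ne', ENNReal.rpow_one]

theorem dilatedMollification_eq_convolution {n : ℕ} (φ : Rn n → ℝ) (l : ℝ) (U : Rn n → ℝ) :
    dilatedMollification φ l U =
      convolution (fun t => U (l • t)) φ (ContinuousLinearMap.mul ℝ ℝ) volume := by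
  ext x
  simp [dilatedMollification, convolution, mul_comm]

theorem contDiff_dilatedMollification {n : ℕ} {U : Rn n → ℝ} (hUi : Integrable U) {φ : Rn n → ℝ}
    (hφ : ContDiff ℝ ∞ φ) (hφs : HasCompactSupport φ) {l : ℝ} (hl : l ≠ 0) :
    ContDiff ℝ 1 (dilatedMollification φ l U) := by
  rw [dilatedMollification_eq_convolution]
  exact hφs.contDiff_convolution_right (n := 1) _ (hUi.comp_smul hl).locallyIntegrable
    (hφ.of_le (by exact_mod_cast le_top))

theorem fderiv_dilatedMollification {n : ℕ} {U : Rn n → ℝ} (hUi : Integrable U) {φ : Rn n → ℝ}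
    (hφ : ContDiff ℝ ∞ φ) (hφs : HasCompactSupport φ) {l : ℝ} (hl : l ≠ 0) (x w : Rn n) :
    fderiv ℝ (dilatedMollification φ l U) x w = ∫ t, fderiv ℝ φ (x - t) w * U (l • t) := by
  have hφ1 : ContDiff ℝ 1 φ := hφ.of_le (by exact_mod_cast le_top)
  have hloc := (hUi.comp_smul hl).locallyIntegrable
  rw [dilatedMollification_eq_convolution,
    (hφs.hasFDerivAt_convolution_right (ContinuousLinearMap.mul ℝ ℝ) hloc hφ1 x).fderiv,
    convolution_precompR_apply _ hloc (hφs.fderiv ℝ) (hφ1.continuous_fderiv one_ne_zero)]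
  simp [convolution, mul_comm]

/-- The gradient of the dilated mollification of `u` is `l` times the dilated mollification of
the weak gradient: `z ↦ φ (x - l⁻¹ • z)` is an admissible test function. -/
theorem gradient_dilatedMollification {n : ℕ} {Ω : Set (Rn n)} {U : Rn n → ℝ} {G : Rn n → Rn n}
    (hUi : Integrable U) (hGi : Integrable G) (hU0 : ∀ x ∉ Ω, U x = 0) (hG0 : ∀ x ∉ Ω, G x = 0)
    (hweak : ∀ φ : Rn n → ℝ, ContDiff ℝ ∞ φ → HasCompactSupport φ → tsupport φ ⊆ Ω →
      ∀ w : Rn n, ∫ x in Ω, U x * fderiv ℝ φ x w = - ∫ x in Ω, inner ℝ (G x) w * φ x)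
    {φ : Rn n → ℝ} (hφ : ContDiff ℝ ∞ φ) (hφs : HasCompactSupport φ) {l : ℝ} (hl : 0 < l)
    {x : Rn n} (hx : ∀ y ∈ tsupport φ, l • (x - y) ∈ Ω) :
    gradient (dilatedMollification φ l U) x = l • dilatedMollification φ l G x := by
  have hl0 := hl.ne'
  set ψ : Rn n → ℝ := fun z => φ (x - l⁻¹ • z) with hψ
  have hψd : ContDiff ℝ ∞ ψ := hφ.comp (by fun_prop)
  set K : Set (Rn n) := (fun y => l • (x - y)) '' tsupport φ with hK
  have hKc : IsCompact K := hφs.isCompact.image (by fun_prop)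
  have hψK : Function.support ψ ⊆ K := fun z hz =>
    ⟨x - l⁻¹ • z, subset_tsupport _ hz, by simp [smul_smul, mul_inv_cancel₀ hl0]⟩
  have hKΩ : K ⊆ Ω := by
    rintro _ ⟨y, hy, rfl⟩
    exact hx y hy
  have hψs : HasCompactSupport ψ := HasCompactSupport.of_support_subset_isCompact hKc hψK
  have hψΩ : tsupport ψ ⊆ Ω := (closure_minimal hψK hKc.isClosed).trans hKΩ
  refine ext_inner_right ℝ fun w => ?_
  have hderψ : ∀ z, fderiv ℝ ψ z w = -l⁻¹ * fderiv ℝ φ (x - l⁻¹ • z) w := fun z => by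
    have h1 : HasFDerivAt (fun z : Rn n => x - l⁻¹ • z)
        (-(l⁻¹ • ContinuousLinearMap.id ℝ (Rn n))) z :=
      ((hasFDerivAt_id z).const_smul l⁻¹).const_sub x
    have h2 := ((hφ.differentiable (by simp)) (x - l⁻¹ • z)).hasFDerivAt.comp z h1
    have h3 : fderiv ℝ ψ z = _ := h2.fderiv
    rw [h3]
    simp
  have hw := hweak ψ hψd hψs hψΩ w
  rw [setIntegral_eq_integral_of_forall_compl_eq_zero (fun z hz => by rw [hU0 z hz, zero_mul]),
    setIntegral_eq_integral_of_forall_compl_eq_zero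
      (fun z hz => by rw [hG0 z hz, inner_zero_left, zero_mul])] at hw
  -- both integrals are transported by `z = l • t`
  have c1 : ∫ t, fderiv ℝ φ (x - t) w * U (l • t) =
      |(l ^ n)⁻¹| * (-l * ∫ z, U z * fderiv ℝ ψ z w) := by
    have := Measure.integral_comp_smul volume (fun z => fderiv ℝ φ (x - l⁻¹ • z) w * U z) l
    simp only [smul_smul, inv_mul_cancel₀ hl0, one_smul, finrank_euclideanSpace_fin,
      smul_eq_mul] at this
    rw [this, ← integral_const_mul (-l)]
    congr 1
    refine integral_congr_ae (ae_of_all _ fun z => ?_)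
    simp only [hderψ]
    field_simp
  have c2 : ∫ t, φ (x - t) * inner ℝ (G (l • t)) w =
      |(l ^ n)⁻¹| * ∫ z, inner ℝ (G z) w * ψ z := by
    have := Measure.integral_comp_smul volume (fun z => φ (x - l⁻¹ • z) * inner ℝ (G z) w) l
    simp only [smul_smul, inv_mul_cancel₀ hl0, one_smul, finrank_euclideanSpace_fin,
      smul_eq_mul] at this
    rw [this]
    congr 1
    exact integral_congr_ae (ae_of_all _ fun z => mul_comm _ _)
  have hi : Integrable fun t => φ (x - t) • G (l • t) :=
    (hGi.comp_smul hl0).smul_of_top_right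
      (((hφ.continuous.comp
        (by fun_prop : Continuous fun t : Rn n => x - t)).memLp_top_of_hasCompactSupport
        (hφs.comp_homeomorph (Homeomorph.subLeft x)) volume))
  rw [inner_gradient_left, fderiv_dilatedMollification hUi hφ hφs hl0, c1, hw, inner_smul_left,
    dilatedMollification, real_inner_comm, ← integral_inner hi]
  have c3 : ∫ t, inner ℝ w (φ (x - t) • G (l • t)) = ∫ t, φ (x - t) * inner ℝ (G (l • t)) w := by
    congr 1 with t
    rw [inner_smul_right, real_inner_comm]
  rw [c3, c2]
  simp only [RCLike.conj_to_real]
  ring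

namespace IsRadialProjection

variable {n : ℕ} {Ω : Set (Rn n)} {f : Rn n → Rn n}

/-- Since `l • closure Ω` is a compact subset of `Ω` for `0 < l < 1`, small translations keep
it inside `Ω`. -/
theorem exists_smul_sub_mem (h : IsRadialProjection Ω f) {l : ℝ} (hl0 : 0 < l) (hl1 : l < 1) :
    ∃ δ : ℝ, 0 < δ ∧ ∀ x ∈ Ω, ∀ y : Rn n, ‖y‖ ≤ δ → l • (x - y) ∈ Ω := by
  have hK : IsCompact ((fun x : Rn n => l • x) '' closure Ω) :=
    h.isBounded.isCompact_closure.image (by fun_prop)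
  obtain ⟨δ, hδ, hsub⟩ := hK.exists_cthickening_subset_open h.isOpen (by
    rintro _ ⟨x, hx, rfl⟩
    exact h.smul_mem hx hl0 hl1)
  refine ⟨δ, hδ, fun x hx y hy => hsub ?_⟩
  refine Metric.mem_cthickening_of_dist_le _ (l • x) δ _ ⟨x, subset_closure hx, rfl⟩ ?_
  rw [dist_eq_norm, ← smul_sub, sub_sub_cancel_left, smul_neg, norm_neg, norm_smul,
    Real.norm_of_nonneg hl0.le]
  exact (mul_le_of_le_one_left (norm_nonneg _) hl1.le).trans hy

/-- Quantitative form of the density of `C¹` functions. The gradient of the approximant is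
`l` times a mollification of the weak gradient, and the factor `l` costs the second `η`. -/
theorem exists_contDiff_eLpNorm_le (h : IsRadialProjection Ω f) {p : ℝ} (hp1 : 1 ≤ p)
    {u : Rn n → ℝ} {g : Rn n → Rn n} (hu : MemW1p Ω p u g) {η : ℝ≥0∞} (hη : η ≠ 0) :
    ∃ v : Rn n → ℝ, ContDiff ℝ 1 v ∧
      eLpNorm (fun x => v x - u x) (ENNReal.ofReal p) (volume.restrict Ω) ≤ η ∧
      eLpNorm (fun x => gradient v x - g x) (ENNReal.ofReal p) (volume.restrict Ω) ≤ 2 * η := by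
  have hP1 : 1 ≤ ENNReal.ofReal p := by simpa using hp1
  have hΩm := h.isOpen.measurableSet
  have := h.isFiniteMeasure_volume_restrict
  -- strongly measurable representatives, extended by zero outside `Ω`
  set U : Rn n → ℝ := Ω.indicator (hu.memLp.1.mk u) with hU
  set G : Rn n → Rn n := Ω.indicator (hu.memLp_grad.1.mk g) with hG
  have hUm : StronglyMeasurable U := hu.memLp.1.stronglyMeasurable_mk.indicator hΩm
  have hGm : StronglyMeasurable G := hu.memLp_grad.1.stronglyMeasurable_mk.indicator hΩm
  have hU' : MemLp (hu.memLp.1.mk u) (ENNReal.ofReal p) (volume.restrict Ω) :=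
    (memLp_congr_ae hu.memLp.1.ae_eq_mk).1 hu.memLp
  have hG' : MemLp (hu.memLp_grad.1.mk g) (ENNReal.ofReal p) (volume.restrict Ω) :=
    (memLp_congr_ae hu.memLp_grad.1.ae_eq_mk).1 hu.memLp_grad
  have hULp : MemLp U (ENNReal.ofReal p) volume := (memLp_indicator_iff_restrict hΩm).2 hU'
  have hGLp : MemLp G (ENNReal.ofReal p) volume := (memLp_indicator_iff_restrict hΩm).2 hG'
  have hUi : Integrable U := (integrable_indicator_iff hΩm).2 (hU'.integrable hP1)
  have hGi : Integrable G := (integrable_indicator_iff hΩm).2 (hG'.integrable hP1)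
  have hUu : u =ᵐ[volume.restrict Ω] U := by
    filter_upwards [hu.memLp.1.ae_eq_mk, ae_restrict_mem hΩm] with x h1 h2
    rw [h1, hU, Set.indicator_of_mem h2]
  have hGg : g =ᵐ[volume.restrict Ω] G := by
    filter_upwards [hu.memLp_grad.1.ae_eq_mk, ae_restrict_mem hΩm] with x h1 h2
    rw [h1, hG, Set.indicator_of_mem h2]
  have hweak : ∀ φ : Rn n → ℝ, ContDiff ℝ ∞ φ → HasCompactSupport φ → tsupport φ ⊆ Ω →
      ∀ w : Rn n, ∫ x in Ω, U x * fderiv ℝ φ x w = - ∫ x in Ω, inner ℝ (G x) w * φ x := by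
    intro φ hφ hφs hφΩ w
    have hUφ : ∫ x in Ω, U x * fderiv ℝ φ x w = ∫ x in Ω, u x * fderiv ℝ φ x w :=
      integral_congr_ae (hUu.mono fun x hx => by simp only [hx])
    rw [hUφ, hu.weak_grad φ hφ hφs hφΩ w]
    congr 1
    exact integral_congr_ae (hGg.mono fun x hx => by simp only [hx])
  obtain ⟨δ₁, hδ₁, hδ₁', hdil₁⟩ := exists_eLpNorm_comp_dilation_sub_le hp1 hUm hULp hη
  obtain ⟨δ₂, hδ₂, hδ₂', hdil₂⟩ := exists_eLpNorm_comp_dilation_sub_le hp1 hGm hGLp hη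
  obtain ⟨κ, hκ0, hκ⟩ := ENNReal.exists_nnreal_pos_mul_lt hGLp.2.ne hη
  have hκ0' : (0 : ℝ) < κ := hκ0
  set δ := min (min δ₁ δ₂) κ with hδ
  have hδ0 : 0 < δ := by positivity
  have hδ1 : δ ≤ δ₁ := (min_le_left _ _).trans (min_le_left _ _)
  have hδ2 : δ ≤ δ₂ := (min_le_left _ _).trans (min_le_right _ _)
  set l := 1 - δ with hl
  have hl0 : 0 < l := by linarith
  have hl1 : l < 1 := by linarith
  obtain ⟨δ₃, hδ₃, hmem⟩ := h.exists_smul_sub_mem hl0 hl1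
  set r := min δ δ₃ with hr
  have hr0 : 0 < r := by positivity
  let b : ContDiffBump (0 : Rn n) := ⟨r / 2, r, by positivity, by linarith⟩
  set φ : Rn n → ℝ := b.normed volume with hφ
  have hφd : ContDiff ℝ ∞ φ := b.contDiff_normed
  have hφs : HasCompactSupport φ := b.hasCompactSupport_normed
  have hφt : ∀ y ∈ tsupport φ, ‖y‖ ≤ r := fun y hy => by
    rw [hφ, b.tsupport_normed_eq] at hy
    exact mem_closedBall_zero_iff.1 hy
  have hUle : eLpNorm (fun x => dilatedMollification φ l U x - U x) (ENNReal.ofReal p) volume ≤ η :=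
    eLpNorm_dilatedMollification_sub_le hp1 hUm hUi hφd.continuous hφs b.nonneg_normed
      b.integral_normed hl0 fun y hy => hdil₁ l (by linarith) hl1.le y
        ((hφt y (subset_tsupport _ hy)).trans ((min_le_left _ _).trans hδ1))
  have hGle : eLpNorm (fun x => dilatedMollification φ l G x - G x) (ENNReal.ofReal p) volume ≤ η :=
    eLpNorm_dilatedMollification_sub_le hp1 hGm hGi hφd.continuous hφs b.nonneg_normed
      b.integral_normed hl0 fun y hy => hdil₂ l (by linarith) hl1.le y
        ((hφt y (subset_tsupport _ hy)).trans ((min_le_left _ _).trans hδ2))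
  have hgrad : ∀ x ∈ Ω, gradient (dilatedMollification φ l U) x =
      l • dilatedMollification φ l G x := fun x hx =>
    gradient_dilatedMollification hUi hGi (fun x hx => Set.indicator_of_notMem hx _)
      (fun x hx => Set.indicator_of_notMem hx _) hweak hφd hφs hl0
      fun y hy => hmem x hx y ((hφt y hy).trans (min_le_right _ _))
  have hVd := contDiff_dilatedMollification hUi hφd hφs hl0.ne'
  refine ⟨dilatedMollification φ l U, hVd, ?_, ?_⟩
  · refine (eLpNorm_congr_ae ?_).trans_le ((eLpNorm_mono_measure _ Measure.restrict_le_self).trans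
      hUle)
    exact hUu.mono fun x hx => by simp only [hx]
  · have hVm : AEStronglyMeasurable (fun x => dilatedMollification φ l G x - G x)
        (volume.restrict Ω) := by
      refine AEStronglyMeasurable.sub ?_ hGm.aestronglyMeasurable
      refine (((continuous_gradient hVd).aestronglyMeasurable
        (μ := volume.restrict Ω)).const_smul l⁻¹).congr ?_
      filter_upwards [ae_restrict_mem hΩm] with x hx
      rw [Pi.smul_apply, hgrad x hx, smul_smul, inv_mul_cancel₀ hl0.ne', one_smul]
    calc eLpNorm (fun x => gradient (dilatedMollification φ l U) x - g x) (ENNReal.ofReal p)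
          (volume.restrict Ω)
        = eLpNorm ((l • fun x => dilatedMollification φ l G x - G x) - δ • G) (ENNReal.ofReal p)
            (volume.restrict Ω) := by
          refine eLpNorm_congr_ae ?_
          filter_upwards [hGg, ae_restrict_mem hΩm] with x h1 h2
          rw [hgrad x h2, h1, Pi.sub_apply, Pi.smul_apply, Pi.smul_apply, hl]
          module
      _ ≤ ‖l‖ₑ * eLpNorm (fun x => dilatedMollification φ l G x - G x) (ENNReal.ofReal p)
            (volume.restrict Ω) + ‖δ‖ₑ * eLpNorm G (ENNReal.ofReal p) (volume.restrict Ω) := by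
          rw [← eLpNorm_const_smul, ← eLpNorm_const_smul]
          exact eLpNorm_sub_le (hVm.const_smul l) (hGm.aestronglyMeasurable.const_smul δ) hP1
      _ ≤ 1 * η + η := by
          refine add_le_add (mul_le_mul' ?_ ?_) (le_trans (mul_le_mul' (b := ((κ : ℝ≥0∞))) ?_
            (eLpNorm_mono_measure _ Measure.restrict_le_self)) hκ.le)
          · rw [Real.enorm_of_nonneg hl0.le, ENNReal.ofReal_le_one]
            exact hl1.le
          · exact (eLpNorm_mono_measure _ Measure.restrict_le_self).trans hGle
          · rw [Real.enorm_of_nonneg hδ0.le, ← ENNReal.ofReal_coe_nnreal]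
            exact ENNReal.ofReal_le_ofReal (min_le_right _ _)
      _ = 2 * η := by ring

/-- Restrictions of `C¹` functions are dense in `W^{1,p}(Ω)`. -/
theorem exists_contDiff_tendsto (h : IsRadialProjection Ω f) {p : ℝ} (hp1 : 1 ≤ p)
    {u : Rn n → ℝ} {g : Rn n → Rn n} (hu : MemW1p Ω p u g) :
    ∃ v : ℕ → Rn n → ℝ, (∀ k, ContDiff ℝ 1 (v k)) ∧
      Tendsto (fun k => eLpNorm (fun x => v k x - u x) (ENNReal.ofReal p)
        (volume.restrict Ω)) atTop (𝓝 0) ∧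
      Tendsto (fun k => eLpNorm (fun x => gradient (v k) x - g x) (ENNReal.ofReal p)
        (volume.restrict Ω)) atTop (𝓝 0) := by
  choose v hv hvu hvg using fun k : ℕ => h.exists_contDiff_eLpNorm_le hp1 hu
    (η := (k : ℝ≥0∞)⁻¹) (by simp)
  have h1 : Tendsto (fun k : ℕ => (k : ℝ≥0∞)⁻¹) atTop (𝓝 0) :=
    ENNReal.tendsto_inv_nat_nhds_zero
  have h2 : Tendsto (fun k : ℕ => 2 * (k : ℝ≥0∞)⁻¹) atTop (𝓝 0) := by
    simpa using ENNReal.Tendsto.const_mul (a := 2) h1 (Or.inr (by simp))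
  exact ⟨v, hv, tendsto_of_tendsto_of_tendsto_of_le_of_le tendsto_const_nhds h1
    (fun _ => zero_le) hvu, tendsto_of_tendsto_of_tendsto_of_le_of_le tendsto_const_nhds h2
    (fun _ => zero_le) hvg⟩

end IsRadialProjection

/-! ### The Hardy inequality on star-shaped domains -/

theorem theorem1 (n : ℕ) (hn : 3 ≤ n) (p : ℝ) (hp1 : 1 ≤ p) (hpn : p < n)
    (Ω : Set (Rn n)) (hΩ : IsC1Domain Ω) (hΩ_bdd : Bornology.IsBounded Ω)
    (hΩ_star : StarConvex ℝ (0 : Rn n) Ω)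
    (f : Rn n → Rn n) (hf_C1 : ContDiffOn ℝ 1 f (closure Ω \ {0}))
    (hf_bdd : MemLp f ⊤ (volume.restrict Ω))
    (hf_radial : ∀ x ∈ Ω \ {0}, fderiv ℝ f x x = 0)
    (hf_boundary : ∀ x ∈ frontier Ω, f x = x)
    (u : Rn n → ℝ) (gradu : Rn n → Rn n) (hu : MemW1p Ω p u gradu) :
    (∃ T : Rn n → ℝ, IsTrace Ω p u gradu T) ∧
    ∀ T : Rn n → ℝ, IsTrace Ω p u gradu T →
      IntegrableOn (fun x => |u x - T (f x)| ^ p / ‖x‖ ^ p) Ω volume ∧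
      ∫ x in Ω, |u x - T (f x)| ^ p / ‖x‖ ^ p ≤
        (p / ((n : ℝ) - p)) ^ p * ∫ x in Ω, |inner ℝ (‖x‖⁻¹ • x) (gradu x)| ^ p := by
  have h : IsRadialProjection Ω f := isRadialProjection_of_boundaryValueProblem hΩ.isOpen
    hΩ.isConnected.nonempty hΩ_bdd hΩ_star hf_C1 hf_radial hf_boundary
  have hn2 : 2 ≤ n := by omega
  have : NeZero n := ⟨by omega⟩
  have hp0 : 0 < p := by linarith
  have hnp : 0 < (n : ℝ) - p := by linarith
  have hP0 : ENNReal.ofReal p ≠ 0 := by simpa using hp0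
  refine ⟨?_, fun T hT => ?_⟩
  · obtain ⟨v, hv, hvu, hvg⟩ := h.exists_contDiff_tendsto hp1 hu
    exact h.exists_isTrace hn2 hp1 hpn hu hv hvu hvg
  have hineq := h.eLpNorm_sub_trace_div_le hn2 hp1 hpn hu hT
  set D : Rn n → ℝ := fun x => inner ℝ (‖x‖⁻¹ • x) (gradu x) with hD
  have hinv : AEStronglyMeasurable (fun x : Rn n => ‖x‖⁻¹) (volume.restrict Ω) :=
    measurable_norm.inv.aestronglyMeasurable
  have hDLp : MemLp D (ENNReal.ofReal p) (volume.restrict Ω) :=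
    hu.memLp_grad.of_le ((hinv.smul aestronglyMeasurable_id).inner hu.memLp_grad.1)
      (ae_of_all _ fun x => norm_inner_unit_le _ _)
  set F : Rn n → ℝ := fun x => (u x - T (f x)) / ‖x‖ with hF
  have hTf : AEStronglyMeasurable (fun x => T (f x)) (volume.restrict Ω) :=
    (hT.memLp.1.mono_ac (h.map_absolutelyContinuous hn2)).comp_aemeasurable h.aemeasurable
  have hFm : AEStronglyMeasurable F (volume.restrict Ω) := by
    simp only [hF, div_eq_mul_inv]
    exact (hu.memLp.1.sub hTf).mul hinv
  have hFLp : MemLp F (ENNReal.ofReal p) (volume.restrict Ω) :=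
    ⟨hFm, hineq.trans_lt (ENNReal.mul_lt_top ENNReal.ofReal_lt_top hDLp.2)⟩
  have hFeq : (fun x => |u x - T (f x)| ^ p / ‖x‖ ^ p) = fun x => ‖F x‖ ^ p := by
    ext x
    rw [hF, norm_div, norm_norm, Real.norm_eq_abs, Real.div_rpow (abs_nonneg _) (norm_nonneg _)]
  have hDeq : (fun x => |inner ℝ (‖x‖⁻¹ • x) (gradu x)| ^ p) = fun x => ‖D x‖ ^ p := rfl
  rw [hFeq, hDeq]
  refine ⟨?_, ?_⟩
  · have := hFLp.integrable_norm_rpow hP0 ENNReal.ofReal_ne_top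
    rwa [ENNReal.toReal_ofReal hp0.le] at this
  · rw [hFLp.eLpNorm_eq_integral_rpow_norm hP0 ENNReal.ofReal_ne_top,
      hDLp.eLpNorm_eq_integral_rpow_norm hP0 ENNReal.ofReal_ne_top,
      ENNReal.toReal_ofReal hp0.le, ← ENNReal.ofReal_mul (by positivity),
      ENNReal.ofReal_le_ofReal_iff (by positivity)] at hineq
    have hF0 : 0 ≤ ∫ x in Ω, ‖F x‖ ^ p := by positivity
    have hD0 : 0 ≤ ∫ x in Ω, ‖D x‖ ^ p := by positivity
    have := Real.rpow_le_rpow (by positivity) hineq hp0.le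
    rwa [Real.mul_rpow (by positivity) (by positivity), ← Real.rpow_mul hF0, ← Real.rpow_mul hD0,
      inv_mul_cancel₀ hp0.ne', Real.rpow_one, Real.rpow_one] at this
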